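/- Let $\partial\mathcal T=\{0,1\}^{\mathbb N}$ be the boundary of the rooted binary tree and let $G$ be Grigorchuk's group, generated by the involutions $a,b,c,d$ acting by $a(0w)=1w$, $a(1w)=0w$, $b(0w)=0a(w)$, $b(1w)=1c(w)$, $c(0w)=0a(w)$, $c(1w)=1d(w)$, $d(0w)=0w$, $d(1w)=1b(w)$. For $\xi\in\partial\mathcal T$ let $\Gamma_\xi$ be the orbital Schreier graph: its vertex set is the orbit $G\xi$, and $p,q$ are joined by an (undirected) edge with label $s\in\{a,b,c,d\}$ if and only if $sp=q$. Let $\mathcal F(\xi)$ be the isomorphism class of the rooted labelled graph $(\Gamma_\xi,\xi)$ in the space $\mathcal G_*$ of isomorphism classes of rooted connected locally finite graphs with edge labels in $\{a,b,c,d\}$, equipped with the topology of local convergence. Let $$X:=\overline{\mathcal F(\partial\mathcal T)}\setminus\{\text{isolated points of }\overline{\mathcal F(\partial\mathcal T)}\},$$ on which $G$ acts by moving the root: each generator $s$ moves the root along its edge with label $s$. Let $\nu$ be the $G$-invariant Borel probability measure on $X$, and let $\mu$ be the uniform Bernoulli measure on $\partial\mathcal T$. Let $X_1$ be the set of isomorphism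 classes of rooted graphs obtained as follows: take two copies of the one-ended graph $\Gamma_{1^\infty}$, choose one of the pairs of labels $\{b,c\},\{b,d\},\{c,d\}$, replace the loops with these two labels at the vertex $1^\infty$ of both copies by two edges with these labels joining the two copies of the vertex $1^\infty$, and choose an arbitrary vertex as the root. For $t,u,v,w\in\mathbb R$ and a graph $\Gamma$ with vertex set $V$ that is $\Gamma_\xi$ or a representative of an element of $X\cup X_1$, let $M_\Gamma(t,u,v,w)$ be the bounded self-adjoint operator on $\ell^2(V)$ given by $$(M_\Gamma\varphi)(p)=\sum_{e}w(e)\,\varphi(q_e),$$ where the sum is over all edges $e$ emanating from $p$ (a loop counts once), $q_e$ is the other end of $e$ ($q_e=p$ for a loop), and $w(e)$ is $t,u,v,w$ if the label of $e$ is $a,b,c,d$, respectively. Write $M_\xi=M_{\Gamma_\xi}$, and $M_x=M_\Gamma$ for any representative $\Gamma$ of $x$. **Theorem (Absence of eigenvalues).** Let $t,u,v,w\in\mathbb R$ with $t\ne0$, $u+v\neq0$, $u+w\ne0$, $v+w\ne0$, and assume that $u=v=w$ does not hold. (a) For $\nu$-almost every $x\in X$ the operator $M_x(t,u,v,w)$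 has no eigenvalues. Moreover, for $\mu$-almost every $\xi\in\partial\mathcal T$ the operator $M_\xi(t,u,v,w)$ has no eigenvalues. (b) For every $x\in X_1$ the operator $M_x(t,u,v,w)$ has no eigenvalues. -/

import Mathlib

open MeasureTheory

/-- The four labels, i.e. the names of the generators of Grigorchuk's group. -/
inductive GLabel : Type
  | a | b | c | d

/-- The boundary of the rooted binary tree: infinite words over `{0, 1}`
(`false` is the digit `0`, `true` is the digit `1`). -/
abbrev TreeBoundary : Type := ℕ → Bool

/-- The action of the four generators on infinite words,
`a (0w) = 1w`, `a (1w) = 0w`, `b (0w) = 0 a(w)`, `b (1w) = 1 c(w)`,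
`c (0w) = 0 a(w)`, `c (1w) = 1 d(w)`, `d (0w) = 0w`, `d (1w) = 1 b(w)`:
`genFun s ξ n` is the `n`-th digit of `s ξ`. -/
def genFun : GLabel → TreeBoundary → ℕ → Bool
  | .a, ξ, 0 => !(ξ 0)
  | .a, ξ, n + 1 => ξ (n + 1)
  | .b, ξ, 0 => ξ 0
  | .b, ξ, n + 1 =>
      if ξ 0 = false then genFun .a (fun k => ξ (k + 1)) n else genFun .c (fun k => ξ (k + 1)) n
  | .c, ξ, 0 => ξ 0
  | .c, ξ, n + 1 =>
      if ξ 0 = false then genFun .a (fun k => ξ (k + 1)) n else genFun .d (fun k => ξ (k + 1)) n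
  | .d, ξ, 0 => ξ 0
  | .d, ξ, n + 1 =>
      if ξ 0 = false then ξ (n + 1) else genFun .b (fun k => ξ (k + 1)) n

theorem genFun_involutive (s : GLabel) : Function.Involutive (genFun s) := by
  intro ξ
  funext n
  induction n generalizing s ξ with
  | zero => cases s <;> simp [genFun]
  | succ n ih =>
    cases s with
    | a => simp [genFun]
    | b =>
      have hta := ih .a (fun k => ξ (k + 1))
      have htc := ih .c (fun k => ξ (k + 1))
      by_cases h : ξ 0 = false <;> simp [genFun, h] <;> assumption
    | c =>
      have hta := ih .a (fun k => ξ (k + 1))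
      have htd := ih .d (fun k => ξ (k + 1))
      by_cases h : ξ 0 = false <;> simp [genFun, h] <;> assumption
    | d =>
      have htb := ih .b (fun k => ξ (k + 1))
      by_cases h : ξ 0 = false
      · simp [genFun, h]
      · simp only [genFun, h]
        exact htb

/-- The generators as permutations of the boundary. -/
def gen (s : GLabel) : Equiv.Perm TreeBoundary := (genFun_involutive s).toPerm

theorem gen_gen (s : GLabel) (ξ : TreeBoundary) : gen s (gen s ξ) = ξ := genFun_involutive s ξ

/-- Grigorchuk's group, through its (faithful) action on the boundary of the tree. -/
def GrigorchukGroup : Subgroup (Equiv.Perm TreeBoundary) := Subgroup.closure (Set.range gen)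

theorem gen_mem (s : GLabel) : gen s ∈ GrigorchukGroup :=
  Subgroup.subset_closure ⟨s, rfl⟩

/-- Connected, locally finite, undirected graphs with edges labelled by `a, b, c, d`; loops and
several edges (with different labels) between two vertices are allowed. `Adj s p q` says that
there is an edge with label `s` between `p` and `q`. -/
structure LGraph : Type 1 where
  V : Type
  Adj : GLabel → V → V → Prop
  symm : ∀ s p q, Adj s p q → Adj s q p
  locallyFinite : ∀ p, {e : GLabel × V | Adj e.1 p e.2}.Finite
  connected : ∀ p q, Relation.ReflTransGen (fun p q => ∃ s, Adj s p q) p q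

/-- Rooted graphs. -/
structure RGraph : Type 1 extends LGraph where
  root : V

/-- Isomorphism of rooted labelled graphs. -/
def RGraph.Iso (Γ Δ : RGraph) : Prop :=
  ∃ e : Γ.V ≃ Δ.V, e Γ.root = Δ.root ∧ ∀ s p q, Γ.Adj s p q ↔ Δ.Adj s (e p) (e q)

instance RGraph.setoid : Setoid RGraph where
  r := RGraph.Iso
  iseqv :=
    { refl := fun Γ => ⟨Equiv.refl _, rfl, fun _ _ _ => Iff.rfl⟩
      symm := by
        rintro Γ Δ ⟨e, hr, h⟩
        refine ⟨e.symm, by simp [← hr], fun s p q => ?_⟩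
        simp [h]
      trans := by
        rintro Γ Δ Λ ⟨e, hr, h⟩ ⟨f, hr', h'⟩
        exact ⟨e.trans f, by simp [hr, hr'], fun s p q => by simp [h, h']⟩ }

/-- The space of isomorphism classes of rooted connected graphs labelled by `a, b, c, d`. -/
def GraphSpace : Type 1 := Quotient RGraph.setoid

/-- The isomorphism class of a rooted graph. -/
def RGraph.cls (Γ : RGraph) : GraphSpace := Quotient.mk RGraph.setoid Γ

/-- The set of vertices at combinatorial distance at most `r` from the root. -/
def RGraph.ball (Γ : RGraph) : ℕ → Set Γ.V
  | 0 => {Γ.root}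
  | r + 1 => Γ.ball r ∪ {q | ∃ p ∈ Γ.ball r, ∃ s, Γ.Adj s p q}

/-- The balls of radius `r` around the roots are isomorphic as rooted labelled graphs. -/
def RGraph.BallIso (Γ Δ : RGraph) (r : ℕ) : Prop :=
  ∃ e : Γ.ball r ≃ Δ.ball r,
    (∀ p : Γ.ball r, (p : Γ.V) = Γ.root ↔ ((e p : Δ.ball r) : Δ.V) = Δ.root) ∧
      ∀ (s : GLabel) (p q : Γ.ball r), Γ.Adj s (p : Γ.V) (q : Γ.V) ↔
        Δ.Adj s ((e p : Δ.ball r) : Δ.V) ((e q : Δ.ball r) : Δ.V)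

/-- The topology of local convergence: the classes of graphs whose `r`-ball around the root is
isomorphic to that of `Γ` form the basic neighbourhoods of the class of `Γ`. -/
instance GraphSpace.topologicalSpace : TopologicalSpace GraphSpace :=
  TopologicalSpace.generateFrom
    {U | ∃ (Γ : RGraph) (r : ℕ), U = {y | ∃ Δ : RGraph, Δ.cls = y ∧ Γ.BallIso Δ r}}

instance GraphSpace.measurableSpace : MeasurableSpace GraphSpace := borel GraphSpace

instance GraphSpace.borelSpace : BorelSpace GraphSpace := ⟨rfl⟩

/-- The orbital Schreier graph of `ξ`: its vertices are the points of the orbit of `ξ`, and an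
edge with label `s` joins `p` and `q` if and only if `s p = q`. -/
def orbitalSchreierGraph (ξ : TreeBoundary) : LGraph where
  V := MulAction.orbit GrigorchukGroup ξ
  Adj s p q := gen s p = (q : TreeBoundary)
  symm := by
    intro s p q h
    rw [← h, gen_gen]
  locallyFinite := by
    intro p
    have : Finite GLabel := Finite.of_injective
      (fun s : GLabel => match s with | .a => (0 : Fin 4) | .b => 1 | .c => 2 | .d => 3)
      (by intro s s' h; cases s <;> cases s' <;> simp_all)
    refine Set.Finite.of_injOn (f := Prod.fst) (t := Set.univ) (fun _ _ => trivial) ?_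
      Set.finite_univ
    rintro ⟨s, q⟩ h ⟨s', q'⟩ h' hs
    simp only [Set.mem_ofPred_eq] at h h' hs
    subst hs
    exact Prod.ext rfl (Subtype.ext (h.symm.trans h'))
  connected := by
    have key : ∀ g ∈ GrigorchukGroup, ∀ p q : MulAction.orbit GrigorchukGroup ξ,
        g (p : TreeBoundary) = q → Relation.ReflTransGen
          (fun p q : MulAction.orbit GrigorchukGroup ξ =>
            ∃ s, gen s (p : TreeBoundary) = (q : TreeBoundary)) p q := by
      intro g hg
      induction hg using Subgroup.closure_induction with
      | mem x hx =>
        obtain ⟨s, rfl⟩ := hx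
        exact fun p q h => Relation.ReflTransGen.single ⟨s, h⟩
      | one =>
        intro p q h
        have : p = q := Subtype.ext h
        rw [this]
      | mul x y hx hy ihx ihy =>
        intro p q h
        let y' : GrigorchukGroup := ⟨y, hy⟩
        refine (ihy p (y' • p) rfl).trans (ihx (y' • p) q h)
      | inv x hx ih =>
        intro p q h
        have h1 := ih q p (by rw [← h]; simp)
        clear ih h
        induction h1 with
        | refl => exact Relation.ReflTransGen.refl
        | tail _ hstep ih =>
          obtain ⟨s, hs⟩ := hstep
          exact Relation.ReflTransGen.head ⟨s, by rw [← hs, gen_gen]⟩ ih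
    intro p q
    obtain ⟨g, hg⟩ : ∃ g : GrigorchukGroup, g • p = q := MulAction.exists_smul_eq _ p q
    exact key g.1 g.2 p q (congrArg Subtype.val hg)

/-- The orbital Schreier graph of `ξ`, rooted at `ξ`. -/
def rootedSchreierGraph (ξ : TreeBoundary) : RGraph where
  toLGraph := orbitalSchreierGraph ξ
  root := ⟨ξ, MulAction.mem_orbit_self ξ⟩

/-- The map sending `ξ` to the isomorphism class of its rooted orbital Schreier graph. -/
def schreierMap (ξ : TreeBoundary) : GraphSpace := (rootedSchreierGraph ξ).cls

/-- The space `X` of Schreier graphs: the closure of the set of orbital Schreier graphs, without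
the isolated points of that closure. -/
def schreierSpace : Set GraphSpace :=
  closure (Set.range schreierMap) \
    {x | ∃ U : Set GraphSpace, IsOpen U ∧ U ∩ closure (Set.range schreierMap) = {x}}

open Classical in
/-- Moving the root of a rooted graph along its edge with label `s`. In a Schreier graph exactly
one edge with label `s` emanates from each vertex; if this fails at the root of some other graph,
the root is kept. -/
noncomputable def RGraph.move (s : GLabel) (Γ : RGraph) : RGraph where
  toLGraph := Γ.toLGraph
  root := if h : ∃! q, Γ.Adj s Γ.root q then h.choose else Γ.root

theorem RGraph.move_iso (s : GLabel) (Γ Δ : RGraph) (h : Γ.Iso Δ) :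
    (Γ.move s).Iso (Δ.move s) := by
  obtain ⟨e, hr, ha⟩ := h
  refine ⟨e, ?_, ha⟩
  have hiff : (∃! q, Γ.Adj s Γ.root q) ↔ ∃! q, Δ.Adj s Δ.root q := by
    rw [← hr]
    constructor
    · rintro ⟨q, hq, hu⟩
      refine ⟨e q, (ha _ _ _).1 hq, fun q' hq' => ?_⟩
      rw [← hu (e.symm q') ((ha _ _ _).2 (by simpa using hq'))]
      simp
    · rintro ⟨q, hq, hu⟩
      refine ⟨e.symm q, (ha _ _ _).2 (by simpa using hq), fun q' hq' => ?_⟩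
      rw [← hu (e q') ((ha _ _ _).1 hq')]
      simp
  by_cases hΓ : ∃! q, Γ.Adj s Γ.root q
  · have hΔ := hiff.1 hΓ
    have h1 : (Γ.move s).root = hΓ.choose := dif_pos hΓ
    have h2 : (Δ.move s).root = hΔ.choose := dif_pos hΔ
    rw [h1, h2]
    refine hΔ.choose_spec.2 _ ?_
    have := (ha _ _ _).1 hΓ.choose_spec.1
    rwa [hr] at this
  · have hΔ : ¬ ∃! q, Δ.Adj s Δ.root q := fun h => hΓ (hiff.2 h)
    have h1 : (Γ.move s).root = Γ.root := dif_neg hΓ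
    have h2 : (Δ.move s).root = Δ.root := dif_neg hΔ
    rw [h1, h2]
    exact hr

/-- The action of the generator `s` on isomorphism classes of graphs, by changing the root. -/
noncomputable def GraphSpace.move (s : GLabel) : GraphSpace → GraphSpace :=
  Quotient.map (RGraph.move s) (RGraph.move_iso s)

/-- `ν` is a probability measure on the space `X` of Schreier graphs that is invariant under the
action of Grigorchuk's group on `X` by changing the root. (Invariance under the group is
invariance under its generators.) -/
structure IsInvariantOnSchreierSpace (ν : Measure GraphSpace) : Prop where
  isProbabilityMeasure : IsProbabilityMeasure ν
  concentrated : ν schreierSpaceᶜ = 0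
  invariant : ∀ s, MeasurePreserving (GraphSpace.move s) ν ν

/-- The uniform Bernoulli measure on the boundary of the tree. -/
noncomputable def boundaryMeasure : Measure TreeBoundary :=
  Measure.infinitePi fun _ : ℕ => (PMF.uniformOfFintype Bool).toMeasure

/-- The graph obtained by gluing two copies of `Γ` at their roots, for a set `S` of labels:
in each copy the loops at the root with label in `S` are removed, and for each label in `S` an
edge with this label is put between the two roots. -/
def RGraph.glue (Γ : RGraph) (S : Set GLabel) (hS : S.Nonempty) : LGraph where
  V := Bool × Γ.V
  Adj s p q :=
    (p.1 = q.1 ∧ Γ.Adj s p.2 q.2 ∧ ¬ (s ∈ S ∧ p.2 = Γ.root ∧ q.2 = Γ.root)) ∨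
      (p.1 ≠ q.1 ∧ s ∈ S ∧ p.2 = Γ.root ∧ q.2 = Γ.root)
  symm := by
    rintro s p q (⟨h1, h2, h3⟩ | ⟨h1, h2, h3, h4⟩)
    · exact Or.inl ⟨h1.symm, Γ.symm _ _ _ h2, fun h => h3 ⟨h.1, h.2.2, h.2.1⟩⟩
    · exact Or.inr ⟨h1.symm, h2, h4, h3⟩
  locallyFinite := by
    intro p
    have : Finite GLabel := Finite.of_injective
      (fun s : GLabel => match s with | .a => (0 : Fin 4) | .b => 1 | .c => 2 | .d => 3)
      (by intro s s' h; cases s <;> cases s' <;> simp_all)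
    have h1 : ((fun e : GLabel × Γ.V => (e.1, (p.1, e.2))) ''
        {e : GLabel × Γ.V | Γ.Adj e.1 p.2 e.2}).Finite := (Γ.locallyFinite p.2).image _
    have h2 : ((fun s : GLabel => (s, (!p.1, Γ.root))) '' Set.univ).Finite :=
      Set.finite_univ.image _
    refine (h1.union h2).subset ?_
    rintro ⟨s, i, q⟩ (⟨h, h', -⟩ | ⟨h, -, -, h'⟩)
    · left
      exact ⟨(s, q), h', by simp only at h; simp [h]⟩
    · right
      simp only at h h'
      refine ⟨s, trivial, ?_⟩
      rw [h']
      revert h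
      cases p.1 <;> cases i <;> simp
  connected := by
    set R : Bool × Γ.V → Bool × Γ.V → Prop := fun p q => ∃ s,
      (p.1 = q.1 ∧ Γ.Adj s p.2 q.2 ∧ ¬ (s ∈ S ∧ p.2 = Γ.root ∧ q.2 = Γ.root)) ∨
        (p.1 ≠ q.1 ∧ s ∈ S ∧ p.2 = Γ.root ∧ q.2 = Γ.root) with hR
    have same : ∀ (i : Bool) (p q : Γ.V), Relation.ReflTransGen R (i, p) (i, q) := by
      intro i p q
      induction Γ.connected p q with
      | refl => exact Relation.ReflTransGen.refl
      | @tail q q' _ hstep ih =>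
        obtain ⟨s, hs⟩ := hstep
        by_cases hl : s ∈ S ∧ q = Γ.root ∧ q' = Γ.root
        · rw [hl.2.2, ← hl.2.1]
          exact ih
        · exact ih.tail ⟨s, Or.inl ⟨rfl, hs, hl⟩⟩
    rintro ⟨i, p⟩ ⟨j, q⟩
    by_cases hij : i = j
    · subst hij
      exact same i p q
    · obtain ⟨s, hs⟩ := hS
      refine ((same i p Γ.root).tail ⟨s, Or.inr ⟨hij, hs, rfl, rfl⟩⟩).trans (same j Γ.root q)

/-- The set `X₁`: two copies of the one-ended orbital Schreier graph of `1^∞` are glued at the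
vertex `1^∞` along one of the pairs `(b, c)`, `(b, d)`, `(c, d)`, and an arbitrary vertex is chosen
as the root. -/
def gluedSchreierGraphs : Set GraphSpace :=
  {x | ∃ (S : Set GLabel) (hS : S.Nonempty),
    (S = {.b, .c} ∨ S = {.b, .d} ∨ S = {.c, .d}) ∧
      ∃ p : ((rootedSchreierGraph fun _ => true).glue S hS).V,
        x = RGraph.cls ⟨(rootedSchreierGraph fun _ => true).glue S hS, p⟩}

/-- The weights `t, u, v, w` of the edges with label `a, b, c, d`. -/
def edgeWeight (t u v w : ℝ) : GLabel → ℝ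
  | .a => t
  | .b => u
  | .c => v
  | .d => w

/-- The action of the Laplacian: `(M φ) (p)` is the sum, over all edges emanating from `p`, of the
weight of the edge times the value of `φ` at its other end. -/
noncomputable def LGraph.laplacianFun (Γ : LGraph) (t u v w : ℝ) (φ : Γ.V → ℂ) (p : Γ.V) : ℂ :=
  ∑ e ∈ (Γ.locallyFinite p).toFinset, (edgeWeight t u v w e.1 : ℂ) * φ e.2

/-- The operator `M` on `ℓ²(V)` is the Laplacian of `Γ` with weights `t, u, v, w`. -/
def LGraph.IsLaplacian (Γ : LGraph) (t u v w : ℝ)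
    (M : lp (fun _ : Γ.V => ℂ) 2 →L[ℂ] lp (fun _ : Γ.V => ℂ) 2) : Prop :=
  ∀ (φ : lp (fun _ : Γ.V => ℂ) 2) (p : Γ.V),
    (M φ : Γ.V → ℂ) p = Γ.laplacianFun t u v w (φ : Γ.V → ℂ) p

/-- The Laplacian of `Γ` with weights `t, u, v, w` is a bounded self-adjoint operator on `ℓ²(V)`
without eigenvalues. -/
def LGraph.NoEigenvalues (Γ : LGraph) (t u v w : ℝ) : Prop :=
  ∃ M : lp (fun _ : Γ.V => ℂ) 2 →L[ℂ] lp (fun _ : Γ.V => ℂ) 2,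
    Γ.IsLaplacian t u v w M ∧ IsSelfAdjoint M ∧
      ∀ E : ℂ, ¬ Module.End.HasEigenvalue (M : Module.End ℂ (lp (fun _ : Γ.V => ℂ) 2)) E

/-!
The absence of eigenvalues follows from the three-block form of Gordon's argument.

Each of the graphs in question is a line on which edges with label `a` alternate with double edges
that carry two of the labels `b, c, d`, the third one being the label of loops at both ends of the
double edge. The eigenvalue equation is therefore a second-order difference equation; as `t`,
`u + v`, `u + w` and `v + w` do not vanish, it has transfer matrices, of determinant one, over a
pair of consecutive edges, and these depend only on the loop label. If the sequence of loop labels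
is periodic on three consecutive blocks of length `P`, then the Cayley-Hamilton theorem bounds a
solution at `0` by its values at `-2P`, `-P` and `P` (`norm_le_of_three_blocks`). If this happens
for arbitrarily large `P`, a square-summable solution vanishes (`eq_zero_of_gordon`,
`noEigenvalues_of_line`).

The sequence of loop labels is a ruler sequence. The boundary of the tree is identified with the
`2`-adic integers by `h (1w) = 2 h(w)`, `h (0w) = -1 - 2 h(w)`. In this coordinate `a` acts by
`h ↦ -1 - h`, and each of `b, c, d` acts by `h ↦ -h` on the points it does not fix, so that a step
of length two along the line is the translation by one; the loop label at a vertex is determined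
by the residue modulo three of the `2`-adic valuation of its address. Only the residues of
addresses modulo powers of two are needed (`address`, `HasAddress`). Labels at positions with
valuation below `n` have period `2 ^ n`, and the positions with valuation at least `n` have
distance `2 ^ n`; every second of these has valuation exactly `n`. If one of the others has
valuation `n + 3`, it has the same label as its two neighbours, and there is periodicity with
period `2 ^ n` on nearly four blocks around it (`periodic_around_center`). This occurs near the
root if the digits of the address at the places `n, …, n + 3` are `0, 0, 0, 1`
(`noEigenvalues_of_address`).

If the address is uniformly distributed, this happens for infinitely many `n` almost surely
(`ae_exists_digit_eq`). The uniform distribution is clear for the Bernoulli measure. For an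
invariant measure `ν` on the space `X`, a graph in the closure of the set of Schreier graphs has
an address too, by approximation in finite balls (`RGraph.exists_hasAddress`), the address is
unique, and the invariance under `h ↦ -1 - h` and `h ↦ -h` makes its residues modulo `2 ^ N`
uniformly distributed (`measure_addressClass_le`). The graphs of `X` that are not orbital Schreier
graphs and the isolated points of the closure have ordinary integers as addresses, whose digits
are eventually constant; so they are among the graphs excluded here, and no separate argument
shows that they form a null set.

In the glued graphs the position with address `0` carries one of the three labels, and it is the
centre of a periodic block for every `n` for which `loopLabel n` is this label
(`noEigenvalues_of_iso_glue`).
-/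

/-! ### Systems of involutions with the local structure of a Schreier graph -/

/-- The cyclic permutation of the labels `b, c, d` by which the loop label changes when a digit `1`
is put in front of an infinite word. -/
def GLabel.rot : GLabel → GLabel
  | .a => .a
  | .b => .d
  | .c => .b
  | .d => .c

/-- The label of the generator among `b, c, d` that fixes a word starting with exactly `n` digits
`1`; the sequence is `d, c, b, d, c, b, …`. -/
def loopLabel : ℕ → GLabel
  | 0 => .d
  | n + 1 => (loopLabel n).rot

theorem loopLabel_ne_a (n : ℕ) : loopLabel n ≠ .a := by
  induction n with
  | zero => simp [loopLabel]
  | succ n ih => rw [loopLabel]; revert ih; cases loopLabel n <;> simp [GLabel.rot]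

theorem loopLabel_succ_ne (n : ℕ) : loopLabel (n + 1) ≠ loopLabel n := by
  have := loopLabel_ne_a n
  rw [loopLabel]; revert this; cases loopLabel n <;> simp [GLabel.rot]

theorem loopLabel_add_three (n : ℕ) : loopLabel (n + 3) = loopLabel n := by
  simp only [loopLabel]; cases loopLabel n <;> rfl

theorem GLabel.exists_ne (l : GLabel) : ∃ s : GLabel, s ≠ .a ∧ s ≠ l := by
  cases l
  exacts [⟨.b, by simp, by simp⟩, ⟨.c, by simp, by simp⟩, ⟨.b, by simp, by simp⟩,
    ⟨.b, by simp, by simp⟩]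

/-- Four involutions `σ a, σ b, σ c, σ d` of a set such that `σ b, σ c, σ d` generate an action of
the Klein four-group and every point is fixed by one of these three. The generators of Grigorchuk's
group act in this way on each of their orbits. -/
structure IsKleinSystem {V : Type} (σ : GLabel → V → V) : Prop where
  invol : ∀ s p, σ s (σ s p) = p
  klein : ∀ p, σ .b (σ .c p) = σ .d p
  fixed : ∀ p, σ .b p = p ∨ σ .c p = p ∨ σ .d p = p

open Classical in
/-- The neighbour of `p` along the edges with labels in `{b, c, d}` which are not loops, or `p`
itself if there are no such edges. -/
noncomputable def pairMove {V : Type} (σ : GLabel → V → V) (p : V) : V :=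
  if σ .b p = p then σ .c p else σ .b p

/-- `l` is the only label in `{b, c, d}` for which there is a loop at `p`. -/
def IsLoopLabel {V : Type} (σ : GLabel → V → V) (l : GLabel) (p : V) : Prop :=
  l ≠ .a ∧ ∀ s, s ≠ .a → (σ s p = p ↔ s = l)

theorem IsLoopLabel.unique {V : Type} {σ : GLabel → V → V} {l l' : GLabel} {p : V}
    (h : IsLoopLabel σ l p) (h' : IsLoopLabel σ l' p) : l = l' :=
  (h'.2 l h.1).1 ((h.2 l h.1).2 rfl)

namespace IsKleinSystem

theorem klein' {V : Type} {σ : GLabel → V → V} (h : IsKleinSystem σ) (p : V) :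
    σ .c (σ .b p) = σ .d p := by
  have h1 := h.klein (σ .d p)
  rw [h.invol] at h1
  have h2 := congrArg (σ .b) h1
  rw [h.invol] at h2
  have h3 := congrArg (σ .c) h2
  rw [h.invol] at h3
  exact h3.symm

theorem apply_eq {V : Type} {σ : GLabel → V → V} (h : IsKleinSystem σ) (p : V) (s : GLabel)
    (hs : s ≠ .a) : σ s p = p ∨ σ s p = pairMove σ p := by
  have h1 := h.klein p
  have h2 := h.klein' p
  have h3 := h.invol .b p
  have h4 := h.invol .c p
  have h5 := h.invol .d p
  have h6 := h.fixed p
  have h7 := h.invol .b (σ .c p)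
  have h8 := h.invol .c (σ .b p)
  unfold pairMove
  cases s <;> grind

theorem pairMove_eq {V : Type} {σ : GLabel → V → V} (h : IsKleinSystem σ) {p : V} {l s : GLabel}
    (hl : IsLoopLabel σ l p) (hs : s ≠ .a) (hsl : s ≠ l) : σ s p = pairMove σ p := by
  rcases h.apply_eq p s hs with h' | h'
  · exact absurd ((hl.2 s hs).1 h') hsl
  · exact h'

theorem exists_loopLabel {V : Type} {σ : GLabel → V → V} (h : IsKleinSystem σ) (p : V) :
    (∀ s, s ≠ .a → σ s p = p) ∨ ∃ l, IsLoopLabel σ l p := by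
  have h1 := h.klein p
  have h2 := h.klein' p
  have h6 := h.fixed p
  by_cases hb : σ .b p = p
  · by_cases hc : σ .c p = p
    · left
      rw [hc, hb] at h1
      intro s hs
      cases s <;> grind
    · right
      refine ⟨.b, by simp, fun s hs => ?_⟩
      cases s <;> grind
  · right
    by_cases hc : σ .c p = p
    · refine ⟨.c, by simp, fun s hs => ?_⟩
      cases s <;> grind
    · refine ⟨.d, by simp, fun s hs => ?_⟩
      cases s <;> grind

theorem commute {V : Type} {σ : GLabel → V → V} (h : IsKleinSystem σ) {s l : GLabel}
    (hs : s ≠ .a) (hl : l ≠ .a) (p : V) : σ s (σ l p) = σ l (σ s p) := by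
  have bc := h.klein
  have cb := h.klein'
  have hi := h.invol
  have bd : ∀ p, σ .b (σ .d p) = σ .c p := fun p => by rw [← bc, hi]
  have db : ∀ p, σ .d (σ .b p) = σ .c p := fun p => by rw [← cb, hi]
  have cd : ∀ p, σ .c (σ .d p) = σ .b p := fun p => by rw [← cb, hi]
  have dc : ∀ p, σ .d (σ .c p) = σ .b p := fun p => by rw [← bc, hi]
  cases s <;> cases l <;> simp_all

theorem pairMove_cases {V : Type} {σ : GLabel → V → V} (p : V) :
    ∃ s, s ≠ .a ∧ pairMove σ p = σ s p := by
  unfold pairMove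
  split_ifs
  · exact ⟨.c, by simp, rfl⟩
  · exact ⟨.b, by simp, rfl⟩

theorem isLoopLabel_apply {V : Type} {σ : GLabel → V → V} (h : IsKleinSystem σ) {p : V}
    {l s : GLabel} (hl : IsLoopLabel σ l p) (hs : s ≠ .a) : IsLoopLabel σ l (σ s p) := by
  refine ⟨hl.1, fun r hr => ?_⟩
  rw [← hl.2 r hr, h.commute hr hs]
  exact (Function.LeftInverse.injective (h.invol s)).eq_iff

theorem isLoopLabel_pairMove {V : Type} {σ : GLabel → V → V} (h : IsKleinSystem σ) {p : V}
    {l : GLabel} (hl : IsLoopLabel σ l p) : IsLoopLabel σ l (pairMove σ p) := by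
  obtain ⟨s, hs, h1⟩ := pairMove_cases (σ := σ) p
  rw [h1]
  exact h.isLoopLabel_apply hl hs

theorem pairMove_pairMove {V : Type} {σ : GLabel → V → V} (h : IsKleinSystem σ) (p : V) :
    pairMove σ (pairMove σ p) = p := by
  rcases h.exists_loopLabel p with h1 | ⟨l, hl⟩
  · have h2 : pairMove σ p = p := by
      obtain ⟨s, hs, h3⟩ := pairMove_cases (σ := σ) p
      rw [h3, h1 s hs]
    rw [h2, h2]
  · obtain ⟨s, hs, hsl⟩ := GLabel.exists_ne l
    rw [← h.pairMove_eq (h.isLoopLabel_pairMove hl) hs hsl, ← h.pairMove_eq hl hs hsl, h.invol]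

end IsKleinSystem

/-- The path through `p` that follows alternately the edges with label `a` and the double edges with
labels in `{b, c, d}`: `line σ p k` is its vertex number `2k`, and `σ a (line σ p k)` is its vertex
number `2k + 1`. -/
noncomputable def line {V : Type} (σ : GLabel → V → V) (p : V) : ℤ → V
  | .ofNat n => (fun q => pairMove σ (σ .a q))^[n] p
  | .negSucc n => (fun q => σ .a (pairMove σ q))^[n + 1] p

theorem line_zero {V : Type} (σ : GLabel → V → V) (p : V) : line σ p 0 = p := rfl

namespace IsKleinSystem

theorem line_add_one {V : Type} {σ : GLabel → V → V} (h : IsKleinSystem σ) (p : V) (k : ℤ) :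
    line σ p (k + 1) = pairMove σ (σ .a (line σ p k)) := by
  rcases k with n | n
  · exact Function.iterate_succ_apply' _ n p
  · rcases n with _ | n
    · change p = pairMove σ (σ .a (σ .a (pairMove σ p)))
      rw [h.invol, h.pairMove_pairMove]
    · change (fun q => σ .a (pairMove σ q))^[n + 1] p =
        pairMove σ (σ .a ((fun q => σ .a (pairMove σ q))^[n + 1 + 1] p))
      rw [Function.iterate_succ_apply' _ (n + 1), h.invol, h.pairMove_pairMove]

theorem line_sub_one {V : Type} {σ : GLabel → V → V} (h : IsKleinSystem σ) (p : V) (k : ℤ) :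
    line σ p (k - 1) = σ .a (pairMove σ (line σ p k)) := by
  have := h.line_add_one p (k - 1)
  rw [sub_add_cancel] at this
  rw [this, h.pairMove_pairMove, h.invol]

theorem eq_line {V : Type} {σ : GLabel → V → V} (h : IsKleinSystem σ) {y : ℤ → V}
    (hy : ∀ k, y (k + 1) = pairMove σ (σ .a (y k))) (k : ℤ) : y k = line σ (y 0) k := by
  have hy' : ∀ k, y (k - 1) = σ .a (pairMove σ (y k)) := fun k => by
    have := hy (k - 1)
    rw [sub_add_cancel] at this
    rw [this, h.pairMove_pairMove, h.invol]
  induction k using Int.induction_on with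
  | zero => rfl
  | succ k ih => rw [hy, ih, h.line_add_one]
  | pred k ih => rw [hy', ih, h.line_sub_one]

theorem line_line {V : Type} {σ : GLabel → V → V} (h : IsKleinSystem σ) (p : V) (j k : ℤ) :
    line σ (line σ p j) k = line σ p (j + k) := by
  have := h.eq_line (y := fun k => line σ p (j + k))
    (fun k => by simp only [← add_assoc, h.line_add_one]) k
  simpa using this.symm

theorem line_a {V : Type} {σ : GLabel → V → V} (h : IsKleinSystem σ) (p : V) (k : ℤ) :
    line σ (σ .a p) k = pairMove σ (line σ p (1 - k)) := by
  have h1 := h.eq_line (y := fun k => σ .a (line σ p (-k)))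
    (fun k => by
      rw [h.invol, neg_add, ← sub_eq_add_neg, h.line_sub_one, h.invol]) k
  simp only [neg_zero, line_zero] at h1
  rw [← h1, show (1 - k : ℤ) = -k + 1 by ring, h.line_add_one, h.pairMove_pairMove]

theorem line_pairMove {V : Type} {σ : GLabel → V → V} (h : IsKleinSystem σ) (p : V) (k : ℤ) :
    line σ (pairMove σ p) k = pairMove σ (line σ p (-k)) := by
  have h1 := h.eq_line (y := fun k => pairMove σ (line σ p (-k)))
    (fun k => by
      rw [neg_add, ← sub_eq_add_neg, h.line_sub_one]) k
  simpa only [neg_zero, line_zero] using h1.symm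

end IsKleinSystem

/-! ### Addresses of vertices and the ruler sequence of loop labels -/

/-- `2 ^ i` is the exact power of two dividing `n`. -/
def ExactTwoPow (i : ℕ) (n : ℤ) : Prop := (2 : ℤ) ^ i ∣ n ∧ ¬ (2 : ℤ) ^ (i + 1) ∣ n

namespace ExactTwoPow

theorem neg {i : ℕ} {n : ℤ} (h : ExactTwoPow i n) : ExactTwoPow i (-n) :=
  ⟨(dvd_neg).2 h.1, fun h' => h.2 ((dvd_neg).1 h')⟩

theorem add {i : ℕ} {n m : ℤ} (h : ExactTwoPow i n) (hm : (2 : ℤ) ^ (i + 1) ∣ m) :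
    ExactTwoPow i (n + m) :=
  ⟨dvd_add h.1 ((pow_dvd_pow 2 (Nat.le_succ i)).trans hm), fun h' => h.2 ((dvd_add_left hm).1 h')⟩

theorem congr {i N : ℕ} {n m : ℤ} (h : ExactTwoPow i n) (hi : i < N) (hm : (2 : ℤ) ^ N ∣ n - m) :
    ExactTwoPow i m := by
  have := h.add (m := m - n) (((pow_dvd_pow 2 hi).trans hm).trans (by rw [← neg_sub, neg_dvd]))
  simpa using this

theorem two_pow (i : ℕ) : ExactTwoPow i (2 ^ i) := by
  refine ⟨dvd_rfl, fun h => ?_⟩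
  have h1 := Int.le_of_dvd (by positivity) h
  rw [pow_succ] at h1
  have : (0 : ℤ) < 2 ^ i := by positivity
  linarith

theorem exists_lt {N : ℕ} {n : ℤ} (h : ¬ (2 : ℤ) ^ N ∣ n) : ∃ i < N, ExactTwoPow i n := by
  induction N with
  | zero => simp at h
  | succ N ih =>
    by_cases h' : (2 : ℤ) ^ N ∣ n
    · exact ⟨N, Nat.lt_succ_self N, h', h⟩
    · obtain ⟨i, hi, h1⟩ := ih h'
      exact ⟨i, hi.trans (Nat.lt_succ_self N), h1⟩

end ExactTwoPow

/-- `h` is the `2`-adic address of `p`, as far as it can be seen modulo `2 ^ N`: the loop label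
at vertex number `2k` of the line through `p` is `loopLabel i`, where `i` is the `2`-adic
valuation of `h + k`, whenever `i < N`. -/
def HasAddress {V : Type} (σ : GLabel → V → V) (p : V) (N : ℕ) (h : ℤ) : Prop :=
  ∀ (k : ℤ) (i : ℕ), i < N → ExactTwoPow i (h + k) → IsLoopLabel σ (loopLabel i) (line σ p k)

namespace HasAddress

theorem mono {V : Type} {σ : GLabel → V → V} {p : V} {N M : ℕ} {h : ℤ} (H : HasAddress σ p N h)
    (hM : M ≤ N) : HasAddress σ p M h := fun k i hi => H k i (hi.trans_le hM)

theorem congr {V : Type} {σ : GLabel → V → V} {p : V} {N : ℕ} {h h' : ℤ} (H : HasAddress σ p N h)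
    (hh : (2 : ℤ) ^ N ∣ h' - h) : HasAddress σ p N h' := fun k i hi h1 =>
  H k i hi (h1.congr hi (by rwa [add_sub_add_right_eq_sub]))

/-- Addresses are unique. If two addresses of `p` differ by a number with valuation `m`, then there
is a vertex on the line of `p` to which they assign the valuations `m` and `m + 1`, hence
different loop labels. -/
theorem unique {V : Type} {σ : GLabel → V → V} {p : V} {N : ℕ} {h h' : ℤ}
    (H : HasAddress σ p (N + 1) h) (H' : HasAddress σ p (N + 1) h') : (2 : ℤ) ^ N ∣ h - h' := by
  by_contra hN
  obtain ⟨m, hm, hm'⟩ := ExactTwoPow.exists_lt hN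
  have h1 := H (2 ^ (m + 1) - h') m (by omega) (by
    rw [show h + (2 ^ (m + 1) - h') = (h - h') + 2 ^ (m + 1) by ring]
    exact hm'.add dvd_rfl)
  have h2 := H' (2 ^ (m + 1) - h') (m + 1) (by omega) (by
    rw [add_sub_cancel]
    exact ExactTwoPow.two_pow _)
  exact loopLabel_succ_ne m (h2.unique h1)

/-- If two vertices of the line coincide, then the sequence of loop labels along the line is
periodic, which contradicts the uniqueness of addresses. -/
theorem line_injective {V : Type} {σ : GLabel → V → V} (hσ : IsKleinSystem σ) {p : V}
    (H : ∀ N, ∃ h, HasAddress σ p N h) : Function.Injective (line σ p) := by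
  intro j k hjk
  by_contra hne
  have hall : ∀ N : ℕ, (2 : ℤ) ^ N ∣ j - k := by
    intro N
    obtain ⟨h, hh⟩ := H (N + 1)
    have hs : ∀ j, HasAddress σ (line σ p j) (N + 1) (h + j) := fun j m i hi h1 => by
      rw [hσ.line_line]
      exact hh (j + m) i hi (by rwa [← add_assoc])
    have h1 := hs j
    rw [hjk] at h1
    have := h1.unique (hs k)
    rwa [add_sub_add_left_eq_sub] at this
  have h1 := Int.natAbs_le_of_dvd_ne_zero (hall (j - k).natAbs) (sub_ne_zero.2 hne)
  rw [Int.natAbs_pow] at h1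
  exact absurd h1 (not_le.2 (Nat.lt_pow_self (by norm_num)))

theorem a_move {V : Type} {σ : GLabel → V → V} (hσ : IsKleinSystem σ) {p : V} {N : ℕ} {h : ℤ}
    (H : HasAddress σ p N h) : HasAddress σ (σ .a p) N (-1 - h) := by
  intro k i hi h1
  rw [hσ.line_a]
  refine hσ.isLoopLabel_pairMove (H _ i hi ?_)
  rw [show h + (1 - k) = -(-1 - h + k) by ring]
  exact h1.neg

theorem pairMove_move {V : Type} {σ : GLabel → V → V} (hσ : IsKleinSystem σ) {p : V} {N : ℕ}
    {h : ℤ} (H : HasAddress σ p N h) : HasAddress σ (pairMove σ p) N (-h) := by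
  intro k i hi h1
  rw [hσ.line_pairMove]
  refine hσ.isLoopLabel_pairMove (H _ i hi ?_)
  rw [show h + -k = -(-h + k) by ring]
  exact h1.neg

end HasAddress

theorem map_pairMove_of_injective {V W : Type} {σ : GLabel → V → V} {τ : GLabel → W → W} {f : V → W}
    (hf : Function.Injective f) (hστ : ∀ s p, f (σ s p) = τ s (f p)) (q : V) :
    f (pairMove σ q) = pairMove τ (f q) := by
  unfold pairMove
  by_cases hb : σ .b q = q
  · rw [if_pos hb, if_pos (by rw [← hστ, hb]), hστ]
  · rw [if_neg hb, if_neg (by rwa [← hστ, hf.eq_iff]), hστ]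

theorem IsLoopLabel.of_injective {V W : Type} {σ : GLabel → V → V} {τ : GLabel → W → W} {f : V → W}
    (hf : Function.Injective f) (hστ : ∀ s p, f (σ s p) = τ s (f p)) {l : GLabel} {p : V}
    (h : IsLoopLabel τ l (f p)) : IsLoopLabel σ l p :=
  ⟨h.1, fun s hs => by rw [← h.2 s hs, ← hστ, hf.eq_iff]⟩

theorem IsKleinSystem.of_injective {V W : Type} {σ : GLabel → V → V} {τ : GLabel → W → W}
    (hτ : IsKleinSystem τ) {f : V → W} (hf : Function.Injective f)
    (hστ : ∀ s p, f (σ s p) = τ s (f p)) : IsKleinSystem σ where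
  invol s p := hf (by rw [hστ, hστ, hτ.invol])
  klein p := hf (by rw [hστ, hστ, hστ, hτ.klein])
  fixed p := by
    have h : ∀ s, τ s (f p) = f p → σ s p = p := fun s hs => hf (by rw [hστ, hs])
    exact (hτ.fixed (f p)).imp (h _) (Or.imp (h _) (h _))

theorem HasAddress.of_injective {V W : Type} {σ : GLabel → V → V} {τ : GLabel → W → W}
    (hτ : IsKleinSystem τ) {f : V → W} (hf : Function.Injective f)
    (hστ : ∀ s p, f (σ s p) = τ s (f p)) {p : V} {N : ℕ} {h : ℤ} (H : HasAddress τ (f p) N h) :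
    HasAddress σ p N h := by
  have hline : ∀ k, f (line σ p k) = line τ (f p) k := fun k =>
    hτ.eq_line (y := fun k => f (line σ p k))
      (fun k => by
        rw [(hτ.of_injective hf hστ).line_add_one, map_pairMove_of_injective hf hστ, hστ]) k
  intro k i hi hk
  have := H k i hi hk
  rw [← hline] at this
  exact this.of_injective hf hστ

/-! ### The action of Grigorchuk's group on the boundary -/

/-- The word without its first digit. -/
def TreeBoundary.tail (ξ : TreeBoundary) : TreeBoundary := fun n => ξ (n + 1)

open TreeBoundary (tail)

theorem TreeBoundary.ext_tail {ξ η : TreeBoundary} (h0 : ξ 0 = η 0) (h : tail ξ = tail η) :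
    ξ = η := by
  funext n
  cases n with
  | zero => exact h0
  | succ n => exact congrFun h n

theorem genFun_zero {s : GLabel} (hs : s ≠ .a) (ξ : TreeBoundary) : genFun s ξ 0 = ξ 0 := by
  cases s <;> simp_all [genFun]

theorem tail_genFun_a (ξ : TreeBoundary) : tail (genFun .a ξ) = tail ξ := rfl

theorem tail_genFun_true {s : GLabel} (hs : s ≠ .a) {ξ : TreeBoundary} (h : ξ 0 = true) :
    tail (genFun s ξ) = genFun s.rot.rot (tail ξ) := by
  funext n
  cases s <;> simp_all [genFun, TreeBoundary.tail, GLabel.rot] <;> rfl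

theorem tail_genFun_false {s : GLabel} (hs : s ≠ .a) (hd : s ≠ .d) {ξ : TreeBoundary}
    (h : ξ 0 = false) : tail (genFun s ξ) = genFun .a (tail ξ) := by
  funext n
  cases s <;> simp_all [genFun, TreeBoundary.tail] <;> rfl

theorem genFun_d_false {ξ : TreeBoundary} (h : ξ 0 = false) : genFun .d ξ = ξ := by
  funext n
  cases n <;> simp [genFun, h]

theorem genFun_a_ne (ξ : TreeBoundary) : genFun .a ξ ≠ ξ := by
  intro h
  have := congrFun h 0
  simp [genFun] at this

theorem genFun_true_eq_iff {s : GLabel} (hs : s ≠ .a) {ξ : TreeBoundary} (h : ξ 0 = true) :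
    genFun s ξ = ξ ↔ genFun s.rot.rot (tail ξ) = tail ξ := by
  rw [← tail_genFun_true hs h]
  exact ⟨fun h' => by rw [h'], fun h' => TreeBoundary.ext_tail (genFun_zero hs ξ) h'⟩

theorem genFun_false_eq_iff {s : GLabel} (hs : s ≠ .a) {ξ : TreeBoundary} (h : ξ 0 = false) :
    genFun s ξ = ξ ↔ s = .d := by
  constructor
  · intro h'
    by_contra hd
    have := tail_genFun_false hs hd h
    rw [h'] at this
    exact genFun_a_ne _ this.symm
  · rintro rfl
    exact genFun_d_false h

/-- The relations `bc = d`, `cd = b`, `db = c`; each of them for the words starting with `1` is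
another one for their tails. -/
theorem genFun_klein (n : ℕ) (ξ : TreeBoundary) :
    genFun .b (genFun .c ξ) n = genFun .d ξ n ∧ genFun .c (genFun .d ξ) n = genFun .b ξ n ∧
      genFun .d (genFun .b ξ) n = genFun .c ξ n := by
  induction n generalizing ξ with
  | zero => simp [genFun]
  | succ n ih =>
    have key : ∀ s η, genFun s η (n + 1) = tail (genFun s η) n := fun _ _ => rfl
    have hz : ∀ s, s ≠ .a → genFun s ξ 0 = ξ 0 := fun s hs => genFun_zero hs ξ
    cases h : ξ 0
    · have hb : genFun .b ξ 0 = false := by rw [hz _ (by simp), h]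
      have hc : genFun .c ξ 0 = false := by rw [hz _ (by simp), h]
      have hd := genFun_d_false h
      have hi : genFun .a (genFun .a (tail ξ)) = tail ξ := genFun_involutive .a _
      refine ⟨?_, ?_, ?_⟩
      · rw [hd, key, tail_genFun_false (by simp) (by simp) hc,
          tail_genFun_false (by simp) (by simp) h, hi]
        rfl
      · rw [hd, key, key, tail_genFun_false (by simp) (by simp) h,
          tail_genFun_false (by simp) (by simp) h]
      · rw [genFun_d_false hb, key, key, tail_genFun_false (by simp) (by simp) h,
          tail_genFun_false (by simp) (by simp) h]
    · have hb : genFun .b ξ 0 = true := by rw [hz _ (by simp), h]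
      have hc : genFun .c ξ 0 = true := by rw [hz _ (by simp), h]
      have hd : genFun .d ξ 0 = true := by rw [hz _ (by simp), h]
      have ih' := ih (tail ξ)
      refine ⟨?_, ?_, ?_⟩
      · rw [key, key, tail_genFun_true (by simp) hc, tail_genFun_true (by simp) h,
          tail_genFun_true (by simp) h]
        exact ih'.2.1
      · rw [key, key, tail_genFun_true (by simp) hd, tail_genFun_true (by simp) h,
          tail_genFun_true (by simp) h]
        exact ih'.2.2
      · rw [key, key, tail_genFun_true (by simp) hb, tail_genFun_true (by simp) h,
          tail_genFun_true (by simp) h]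
        exact ih'.1

theorem genFun_ones {s : GLabel} (hs : s ≠ .a) : genFun s (fun _ => true) = fun _ => true := by
  funext n
  induction n generalizing s with
  | zero => rw [genFun_zero hs]
  | succ n ih =>
    change tail (genFun s _) n = true
    rw [tail_genFun_true hs rfl]
    exact ih (by cases s <;> simp_all [GLabel.rot])

theorem genFun_fixed_of_false (n : ℕ) (ξ : TreeBoundary) (h : ξ n = false) :
    ∃ s, s ≠ .a ∧ genFun s ξ = ξ := by
  induction n generalizing ξ with
  | zero => exact ⟨.d, by simp, genFun_d_false h⟩
  | succ n ih =>
    cases h0 : ξ 0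
    · exact ⟨.d, by simp, genFun_d_false h0⟩
    · obtain ⟨s, hs, h1⟩ := ih (tail ξ) h
      refine ⟨s.rot, by cases s <;> simp_all [GLabel.rot], ?_⟩
      rw [genFun_true_eq_iff (by cases s <;> simp_all [GLabel.rot]) h0,
        show s.rot.rot.rot = s by cases s <;> rfl, h1]

theorem isKleinSystem_genFun : IsKleinSystem genFun where
  invol := fun s ξ => genFun_involutive s ξ
  klein := fun ξ => funext fun n => (genFun_klein n ξ).1
  fixed := fun ξ => by
    obtain ⟨s, hs, h⟩ : ∃ s, s ≠ .a ∧ genFun s ξ = ξ := by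
      by_cases h : ∃ n, ξ n = false
      · obtain ⟨n, hn⟩ := h
        exact genFun_fixed_of_false n ξ hn
      · have : ξ = fun _ => true := funext fun n => by simpa using fun hn => h ⟨n, hn⟩
        rw [this]
        exact ⟨.b, by simp, genFun_ones (by simp)⟩
    cases s <;> simp_all

/-- An integer which represents modulo `2 ^ N` the `2`-adic address of a point of the boundary,
given by `h (1w) = 2 h(w)` and `h (0w) = -1 - 2 h(w)`. With this choice, `h (a ξ) = -1 - h ξ` and
`h (s ξ) = - h ξ` for `s = b, c, d` unless `s ξ = ξ`. -/
def address : ℕ → TreeBoundary → ℤ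
  | 0, _ => 0
  | N + 1, ξ => if ξ 0 = true then 2 * address N (tail ξ) else -1 - 2 * address N (tail ξ)

theorem address_ones (N : ℕ) : address N (fun _ => true) = 0 := by
  induction N with
  | zero => rfl
  | succ N ih =>
    have : tail (fun _ => true) = fun _ => true := rfl
    simp [address, this, ih]

theorem address_a (N : ℕ) (ξ : TreeBoundary) :
    (2 : ℤ) ^ N ∣ address N (genFun .a ξ) + 1 + address N ξ := by
  cases N with
  | zero => simp
  | succ N =>
    have h0 : genFun .a ξ 0 = !(ξ 0) := rfl
    simp only [address, tail_genFun_a, h0]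
    cases ξ 0 <;> simp <;> ring_nf <;> exact dvd_zero _

theorem address_apply (N : ℕ) {s : GLabel} (hs : s ≠ .a) (ξ : TreeBoundary) :
    genFun s ξ = ξ ∨ (2 : ℤ) ^ N ∣ address N (genFun s ξ) + address N ξ := by
  induction N generalizing s ξ with
  | zero => simp
  | succ N ih =>
    by_cases h1 : genFun s ξ = ξ
    · exact Or.inl h1
    right
    cases h : ξ 0
    · have hd : s ≠ .d := fun hd => h1 ((genFun_false_eq_iff hs h).2 hd)
      have h2 := address_a N (tail ξ)
      rw [address, address, genFun_zero hs, h, tail_genFun_false hs hd h, pow_succ']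
      have := mul_dvd_mul_left (-2) h2
      rw [neg_mul, neg_dvd] at this
      refine this.trans (dvd_of_eq ?_)
      rw [if_neg (by simp), if_neg (by simp)]
      ring
    · rw [genFun_true_eq_iff hs h] at h1
      have h2 := (ih (s := s.rot.rot) (by cases s <;> simp_all [GLabel.rot])
        (tail ξ)).resolve_left h1
      rw [address, address, genFun_zero hs, h, if_pos rfl, if_pos rfl, tail_genFun_true hs h]
      rw [pow_succ', ← mul_add]
      exact mul_dvd_mul_left _ h2

/-- The valuation of the address of `ξ` is the number of digits `1` at the beginning of `ξ`. -/
theorem isLoopLabel_of_address {N i : ℕ} (hi : i < N) {ξ : TreeBoundary}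
    (h : ExactTwoPow i (address N ξ)) : IsLoopLabel genFun (loopLabel i) ξ := by
  refine ⟨loopLabel_ne_a i, ?_⟩
  induction N generalizing i ξ with
  | zero => omega
  | succ N ih =>
    intro s hs
    cases h0 : ξ 0
    · simp only [address, h0, Bool.false_eq_true, if_false] at h
      have : i = 0 := by
        by_contra hi0
        have h1 := (dvd_pow_self (2 : ℤ) hi0).trans h.1
        omega
      subst this
      exact genFun_false_eq_iff hs h0
    · simp only [address, h0, if_true] at h
      obtain _ | i := i
      · exact absurd (Dvd.intro (address N (tail ξ)) (by ring)) h.2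
      · have h1 : ExactTwoPow i (address N (tail ξ)) := by
          refine ⟨?_, fun h' => h.2 ?_⟩
          · have := h.1
            rw [pow_succ'] at this
            exact (mul_dvd_mul_iff_left two_ne_zero).1 this
          · rw [pow_succ']
            exact mul_dvd_mul_left _ h'
        rw [genFun_true_eq_iff hs h0, ih (by omega) h1 _ (by cases s <;> simp_all [GLabel.rot]),
          loopLabel]
        cases s <;> cases loopLabel i <;> simp_all [GLabel.rot]

theorem address_pairMove (N : ℕ) (ξ : TreeBoundary) :
    (2 : ℤ) ^ N ∣ address N (pairMove genFun ξ) + address N ξ := by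
  by_cases hN : (2 : ℤ) ^ N ∣ address N ξ
  · obtain ⟨s, hs, h1⟩ := IsKleinSystem.pairMove_cases (σ := genFun) ξ
    rw [h1]
    rcases address_apply N hs ξ with h2 | h2
    · rw [h2]
      exact dvd_add hN hN
    · exact h2
  · obtain ⟨i, hi, h1⟩ := ExactTwoPow.exists_lt hN
    have hl := isLoopLabel_of_address hi h1
    obtain ⟨s, hs, hsl⟩ := GLabel.exists_ne (loopLabel i)
    rw [← isKleinSystem_genFun.pairMove_eq hl hs hsl]
    exact (address_apply N hs ξ).resolve_left fun h2 => hsl ((hl.2 s hs).1 h2)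

/-- One step along the line is the translation by one on the addresses. -/
theorem address_line (N : ℕ) (ξ : TreeBoundary) (k : ℤ) :
    (2 : ℤ) ^ N ∣ address N ξ + k - address N (line genFun ξ k) := by
  have step : ∀ η : TreeBoundary,
      (2 : ℤ) ^ N ∣ address N η + 1 - address N (pairMove genFun (genFun .a η)) := fun η => by
    have := dvd_sub (address_a N η) (address_pairMove N (genFun .a η))
    exact this.trans (dvd_of_eq (by ring))
  induction k using Int.induction_on with
  | zero => simp [line_zero]
  | succ k ih =>
    have := dvd_add ih (step (line genFun ξ k))
    rw [isKleinSystem_genFun.line_add_one]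
    exact this.trans (dvd_of_eq (by ring))
  | pred k ih =>
    have h1 := step (line genFun ξ (-k - 1))
    rw [← isKleinSystem_genFun.line_add_one, sub_add_cancel] at h1
    have := dvd_sub ih h1
    exact this.trans (dvd_of_eq (by ring))

theorem hasAddress_genFun (N : ℕ) (ξ : TreeBoundary) : HasAddress genFun ξ N (address N ξ) :=
  fun k _ hi h => isLoopLabel_of_address hi (h.congr hi (address_line N ξ k))

/-! ### The three-block argument of Gordon -/

/-- The product of the `n` matrices `A (j + n - 1), …, A j`. -/
def transferProd (A : ℤ → Matrix (Fin 2) (Fin 2) ℂ) (j : ℤ) : ℕ → Matrix (Fin 2) (Fin 2) ℂ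
  | 0 => 1
  | n + 1 => A (j + n) * transferProd A j n

theorem det_transferProd {A : ℤ → Matrix (Fin 2) (Fin 2) ℂ} (hA : ∀ k, (A k).det = 1) (j : ℤ)
    (n : ℕ) : (transferProd A j n).det = 1 := by
  induction n with
  | zero => simp [transferProd]
  | succ n ih => rw [transferProd, Matrix.det_mul, hA, ih, one_mul]

theorem transferProd_mulVec {A : ℤ → Matrix (Fin 2) (Fin 2) ℂ} {Φ : ℤ → Fin 2 → ℂ}
    (hΦ : ∀ k, Φ (k + 1) = (A k).mulVec (Φ k)) (j : ℤ) (n : ℕ) :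
    Φ (j + n) = (transferProd A j n).mulVec (Φ j) := by
  induction n with
  | zero => simp [transferProd]
  | succ n ih =>
    rw [transferProd, ← Matrix.mulVec_mulVec, ← ih, ← hΦ]
    push_cast
    rw [add_assoc]

theorem transferProd_congr {A : ℤ → Matrix (Fin 2) (Fin 2) ℂ} {i j : ℤ} {n : ℕ}
    (h : ∀ m : ℕ, m < n → A (i + m) = A (j + m)) : transferProd A i n = transferProd A j n := by
  induction n with
  | zero => rfl
  | succ n ih =>
    rw [transferProd, transferProd, ih fun m hm => h m (by omega), h n (by omega)]

/-- The Cayley-Hamilton theorem for a matrix with determinant one. -/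
theorem cayley_hamilton_two (T : Matrix (Fin 2) (Fin 2) ℂ) (hT : T.det = 1) (x : Fin 2 → ℂ) :
    T.mulVec (T.mulVec x) + x = T.trace • T.mulVec x := by
  rw [Matrix.det_fin_two] at hT
  ext i
  fin_cases i
  · simp [Fin.sum_univ_two, Matrix.trace]
    linear_combination (-x 0) * hT
  · simp [Fin.sum_univ_two, Matrix.trace]
    linear_combination (-x 1) * hT

/-- If the transfer matrices have determinant one and are periodic on three consecutive blocks of
length `P`, a solution cannot be small at all of `-2P`, `-P`, `P` compared to its size at `0`. By
the Cayley-Hamilton theorem the transfer matrix `T` over one block satisfies `T² + 1 = τ T` with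
`τ = tr T`; this is used at `-2P` if `|τ| ≤ 1` and at `-P` if `|τ| ≥ 1`. -/
theorem norm_le_of_three_blocks {A : ℤ → Matrix (Fin 2) (Fin 2) ℂ} (hA : ∀ k, (A k).det = 1)
    {Φ : ℤ → Fin 2 → ℂ} (hΦ : ∀ k, Φ (k + 1) = (A k).mulVec (Φ k)) {P : ℕ}
    (hP : ∀ k : ℤ, -(2 * P) ≤ k → k < 0 → A k = A (k + P)) :
    ‖Φ 0‖ ≤ ‖Φ P‖ + ‖Φ (-P)‖ + ‖Φ (-(2 * P))‖ := by
  set T := transferProd A (-(2 * P)) P with hT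
  have hdet : T.det = 1 := det_transferProd hA _ _
  have hT1 : transferProd A (-P) P = T := by
    refine transferProd_congr fun m hm => ?_
    rw [hP (-(2 * P) + m) (by omega) (by omega)]
    congr 1
    ring
  have hT0 : transferProd A 0 P = T := by
    rw [← hT1]
    refine transferProd_congr fun m hm => ?_
    rw [hP (-P + m) (by omega) (by omega)]
    congr 1
    ring
  have h1 : Φ (-P) = T.mulVec (Φ (-(2 * P))) := by
    have := transferProd_mulVec hΦ (-(2 * P)) P
    rwa [show -(2 * (P : ℤ)) + P = -P by ring] at this
  have h2 : Φ 0 = T.mulVec (Φ (-P)) := by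
    have := transferProd_mulVec hΦ (-P) P
    rwa [hT1, neg_add_cancel] at this
  have h3 : Φ P = T.mulVec (Φ 0) := by
    have := transferProd_mulVec hΦ 0 P
    rwa [hT0, zero_add] at this
  have c1 := cayley_hamilton_two T hdet (Φ (-(2 * P)))
  rw [← h1, ← h2] at c1
  have c2 := cayley_hamilton_two T hdet (Φ (-P))
  rw [← h2, ← h3] at c2
  have n1 := norm_nonneg (Φ P)
  have n2 := norm_nonneg (Φ (-P))
  have n3 := norm_nonneg (Φ (-(2 * P)))
  rcases le_total ‖T.trace‖ 1 with ht | ht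
  · have : Φ 0 = T.trace • Φ (-P) - Φ (-(2 * P)) := by rw [← c1, add_sub_cancel_right]
    have h4 : ‖Φ 0‖ ≤ ‖T.trace‖ * ‖Φ (-P)‖ + ‖Φ (-(2 * P))‖ := by
      rw [this, ← norm_smul]
      exact norm_sub_le _ _
    nlinarith
  · have h4 : ‖T.trace‖ * ‖Φ 0‖ ≤ ‖Φ P‖ + ‖Φ (-P)‖ := by
      rw [← norm_smul, ← c2]
      exact norm_add_le _ _
    nlinarith [norm_nonneg (Φ 0)]

/-- A solution that tends to zero vanishes if the transfer matrices have three consecutive periodic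
blocks around `0` for arbitrarily large periods. -/
theorem eq_zero_of_gordon {A : ℤ → Matrix (Fin 2) (Fin 2) ℂ} (hA : ∀ k, (A k).det = 1)
    {Φ : ℤ → Fin 2 → ℂ} (hΦ : ∀ k, Φ (k + 1) = (A k).mulVec (Φ k))
    (hlim : Filter.Tendsto Φ Filter.cofinite (nhds 0))
    (hper : ∀ M : ℕ, ∃ P : ℕ, M ≤ P ∧ ∀ k : ℤ, -(2 * P) ≤ k → k < 0 → A k = A (k + P)) (k : ℤ) :
    Φ k = 0 := by
  have h0 : Φ 0 = 0 := by
    by_contra hne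
    have hpos : 0 < ‖Φ 0‖ / 3 := by
      have := norm_pos_iff.2 hne
      positivity
    have hev := (Metric.tendsto_nhds.1 hlim) _ hpos
    simp only [dist_zero_right] at hev
    rw [Filter.eventually_cofinite] at hev
    obtain ⟨M, hM⟩ := (hev.image Int.natAbs).bddAbove
    have small : ∀ k : ℤ, M < k.natAbs → ‖Φ k‖ < ‖Φ 0‖ / 3 := fun k hk => by
      by_contra h
      exact absurd (hM ⟨k, h, rfl⟩) (by omega)
    obtain ⟨P, hMP, hP⟩ := hper (M + 1)
    have := norm_le_of_three_blocks hA hΦ hP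
    have h1 := small P (by omega)
    have h2 := small (-P) (by omega)
    have h3 := small (-(2 * P)) (by omega)
    linarith
  have inj : ∀ k, Φ (k + 1) = 0 → Φ k = 0 := fun k hk => by
    rw [hΦ] at hk
    refine Matrix.eq_zero_of_mulVec_eq_zero (by rw [hA]; exact one_ne_zero) hk
  induction k using Int.induction_on with
  | zero => exact h0
  | succ k ih => rw [hΦ, ih, Matrix.mulVec_zero]
  | pred k ih => exact inj _ (by rwa [sub_add_cancel])

/-! ### The Laplacian of a graph that carries a Klein system -/

/-- The edges of `Γ` are given by the functions `σ`: the only edge with label `s` that emanates from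
`p` ends at `σ s p`. -/
def LGraph.Represents (Γ : LGraph) (σ : GLabel → Γ.V → Γ.V) : Prop :=
  ∀ s p q, Γ.Adj s p q ↔ σ s p = q

theorem LGraph.Represents.laplacianFun_eq {Γ : LGraph} {σ : GLabel → Γ.V → Γ.V}
    (h : Γ.Represents σ) (t u v w : ℝ) (φ : Γ.V → ℂ) (p : Γ.V) :
    Γ.laplacianFun t u v w φ p =
      t * φ (σ .a p) + u * φ (σ .b p) + v * φ (σ .c p) + w * φ (σ .d p) := by
  classical
  have : (Γ.locallyFinite p).toFinset =
      {(.a, σ .a p), (.b, σ .b p), (.c, σ .c p), (.d, σ .d p)} := by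
    ext ⟨s, q⟩
    simp only [Set.Finite.mem_toFinset, Set.mem_ofPred_eq, h s p q, Finset.mem_insert,
      Finset.mem_singleton, Prod.mk.injEq]
    cases s <;> simp [eq_comm]
  rw [LGraph.laplacianFun, this, Finset.sum_insert (by simp), Finset.sum_insert (by simp),
    Finset.sum_insert (by simp), Finset.sum_singleton]
  simp only [edgeWeight]
  ring

theorem memℓp_comp {V : Type} (e : V ≃ V) (φ : lp (fun _ : V => ℂ) 2) :
    Memℓp (fun p => (φ : V → ℂ) (e p)) 2 := by
  have h := lp.memℓp φ
  rw [memℓp_gen_iff (by norm_num)] at h ⊢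
  exact e.summable_iff.2 h

/-- Composition with a permutation of the index set, as an operator on `ℓ²`. -/
noncomputable def lpComp {V : Type} (e : V ≃ V) :
    lp (fun _ : V => ℂ) 2 →L[ℂ] lp (fun _ : V => ℂ) 2 :=
  LinearMap.mkContinuous
    { toFun := fun φ => ⟨fun p => φ (e p), memℓp_comp e φ⟩
      map_add' := fun φ ψ => rfl
      map_smul' := fun c φ => rfl } 1 (fun φ => by
        rw [one_mul, lp.norm_eq_tsum_rpow (by norm_num), lp.norm_eq_tsum_rpow (by norm_num)]
        exact le_of_eq (congrArg (· ^ _) (e.tsum_eq fun p => ‖φ p‖ ^ (2 : ENNReal).toReal)))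

theorem lpComp_apply {V : Type} (e : V ≃ V) (φ : lp (fun _ : V => ℂ) 2) (p : V) :
    (lpComp e φ : V → ℂ) p = φ (e p) := rfl

theorem isSelfAdjoint_lpComp {V : Type} (e : V ≃ V) (he : ∀ p, e (e p) = p) :
    IsSelfAdjoint (lpComp e) := by
  rw [ContinuousLinearMap.isSelfAdjoint_iff_isSymmetric]
  intro φ ψ
  simp only [ContinuousLinearMap.coe_coe]
  rw [lp.inner_eq_tsum, lp.inner_eq_tsum, ← e.tsum_eq]
  simp only [lpComp_apply, he]

theorem exists_isLaplacian {Γ : LGraph} {σ : GLabel → Γ.V → Γ.V} (h : Γ.Represents σ)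
    (hσ : ∀ s p, σ s (σ s p) = p) (t u v w : ℝ) :
    ∃ M : lp (fun _ : Γ.V => ℂ) 2 →L[ℂ] lp (fun _ : Γ.V => ℂ) 2,
      Γ.IsLaplacian t u v w M ∧ IsSelfAdjoint M := by
  let T : GLabel → lp (fun _ : Γ.V => ℂ) 2 →L[ℂ] lp (fun _ : Γ.V => ℂ) 2 := fun s =>
    lpComp (Function.Involutive.toPerm (σ s) (hσ s))
  have hT : ∀ s, IsSelfAdjoint (T s) := fun s => isSelfAdjoint_lpComp _ (hσ s)
  have hr : ∀ r : ℝ, IsSelfAdjoint (r : ℂ) := fun r => Complex.conj_ofReal r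
  refine ⟨(t : ℂ) • T .a + (u : ℂ) • T .b + (v : ℂ) • T .c + (w : ℂ) • T .d, ?_, ?_⟩
  · intro φ p
    rw [h.laplacianFun_eq]
    rfl
  · exact ((((hr t).smul (hT _)).add ((hr u).smul (hT _))).add ((hr v).smul (hT _))).add
      ((hr w).smul (hT _))

theorem tendsto_cofinite_of_lp {V : Type} (φ : lp (fun _ : V => ℂ) 2) {y : ℤ → V}
    (hy : Function.Injective y) : Filter.Tendsto (fun k => φ (y k)) Filter.cofinite (nhds 0) := by
  have h := (memℓp_gen_iff (by norm_num)).1 (lp.memℓp φ)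
  have h1 := (h.tendsto_cofinite_zero).comp hy.tendsto_cofinite
  rw [tendsto_zero_iff_norm_tendsto_zero]
  have h2 := (h1.sqrt)
  simpa [Function.comp_def, Real.sqrt_sq] using h2

/-- At a vertex with exactly one loop with label in `{b, c, d}`, the Laplacian is that of a line:
the two other labels belong to a double edge. -/
theorem edge_sum_eq {V : Type} {σ : GLabel → V → V} (hσ : IsKleinSystem σ) {l : GLabel} {p : V}
    (hl : IsLoopLabel σ l p) (t u v w : ℝ) (φ : V → ℂ) :
    t * φ (σ .a p) + u * φ (σ .b p) + v * φ (σ .c p) + w * φ (σ .d p) =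
      t * φ (σ .a p) + edgeWeight t u v w l * φ p +
        (u + v + w - edgeWeight t u v w l) * φ (pairMove σ p) := by
  classical
  have h1 : ∀ s, s ≠ .a → σ s p = if s = l then p else pairMove σ p := fun s hs => by
    split_ifs with h
    · exact (hl.2 s hs).2 h
    · exact hσ.pairMove_eq hl hs h
  rw [h1 .b (by simp), h1 .c (by simp), h1 .d (by simp)]
  have := hl.1
  cases l <;> simp [edgeWeight] at this ⊢ <;> ring

/-- A graph with a Klein system has no eigenvalues if along an injective line the loop labels are
periodic on three consecutive blocks, for infinitely many periods. -/
theorem noEigenvalues_of_line {Γ : LGraph} {σ : GLabel → Γ.V → Γ.V} (hΓ : Γ.Represents σ)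
    (hσ : IsKleinSystem σ) {y : ℤ → Γ.V} (hy : ∀ k, y (k + 1) = pairMove σ (σ .a (y k)))
    (hinj : Function.Injective y) {l : ℤ → GLabel} (hl : ∀ k, IsLoopLabel σ (l k) (y k))
    (hper : ∀ M : ℕ, ∃ P : ℕ, M ≤ P ∧ ∀ k : ℤ, -(2 * P) < k → k ≤ 0 → l k = l (k + P))
    {t u v w : ℝ} (ht : t ≠ 0) (huv : u + v ≠ 0) (huw : u + w ≠ 0) (hvw : v + w ≠ 0) :
    Γ.NoEigenvalues t u v w := by
  obtain ⟨M, hM, hsa⟩ := exists_isLaplacian hΓ hσ.invol t u v w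
  refine ⟨M, hM, hsa, fun E hE => ?_⟩
  obtain ⟨φ, hφ⟩ := hE.exists_hasEigenvector
  refine hφ.2 ?_
  have heq : ∀ p, E * φ p =
      t * φ (σ .a p) + u * φ (σ .b p) + v * φ (σ .c p) + w * φ (σ .d p) := fun p => by
    rw [← hΓ.laplacianFun_eq, ← hM φ p]
    have := hφ.apply_eq_smul
    simp only [ContinuousLinearMap.coe_coe] at this
    rw [this]
    rfl
  have ha : ∀ k, pairMove σ (y (k + 1)) = σ .a (y k) := fun k => by
    rw [hy, hσ.pairMove_pairMove]
  have hl' : ∀ k, IsLoopLabel σ (l (k + 1)) (σ .a (y k)) := fun k => by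
    rw [← ha]
    exact hσ.isLoopLabel_pairMove (hl (k + 1))
  set V : ℤ → ℂ := fun k => edgeWeight t u v w (l k) with hV
  set J : ℤ → ℂ := fun k => u + v + w - edgeWeight t u v w (l k) with hJ
  have hJ0 : ∀ k, J k ≠ 0 := fun k => by
    have h1 : (u : ℂ) + v ≠ 0 := by exact_mod_cast huv
    have h2 : (u : ℂ) + w ≠ 0 := by exact_mod_cast huw
    have h3 : (v : ℂ) + w ≠ 0 := by exact_mod_cast hvw
    have := (hl k).1
    rw [hJ]
    simp only
    cases h : l k
    · exact absurd h this
    · simp only [edgeWeight]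
      rwa [show (u : ℂ) + v + w - u = v + w by ring]
    · simp only [edgeWeight]
      rwa [show (u : ℂ) + v + w - v = u + w by ring]
    · simp only [edgeWeight]
      rwa [show (u : ℂ) + v + w - w = u + v by ring]
  have ht0 : (t : ℂ) ≠ 0 := by exact_mod_cast ht
  have e1 : ∀ k, E * φ (y (k + 1)) =
      t * φ (σ .a (y (k + 1))) + V (k + 1) * φ (y (k + 1)) + J (k + 1) * φ (σ .a (y k)) :=
    fun k => by rw [heq, edge_sum_eq hσ (hl (k + 1)), ha]
  have e2 : ∀ k, E * φ (σ .a (y k)) =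
      t * φ (y k) + V (k + 1) * φ (σ .a (y k)) + J (k + 1) * φ (y (k + 1)) :=
    fun k => by rw [heq, edge_sum_eq hσ (hl' k), hσ.invol, ← hy]
  -- The transfer matrix over one double edge and one edge with label `a`; it depends only on the
  -- loop label at the double edge.
  let A : ℤ → Matrix (Fin 2) (Fin 2) ℂ := fun k =>
    !![-t / J (k + 1), (E - V (k + 1)) / J (k + 1);
      -(E - V (k + 1)) / J (k + 1), (E - V (k + 1)) ^ 2 / (t * J (k + 1)) - J (k + 1) / t]
  let Φ : ℤ → Fin 2 → ℂ := fun k => ![φ (y k), φ (σ .a (y k))]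
  have hΦ0 : ∀ k, Φ k = 0 := by
    refine eq_zero_of_gordon (A := A) (Φ := Φ) ?_ ?_ ?_ ?_
    · intro k
      have := hJ0 (k + 1)
      simp only [A, Matrix.det_fin_two_of]
      field_simp
      ring
    · intro k
      have hj := hJ0 (k + 1)
      have f1 := e1 k
      have f2 := e2 k
      have g0 : φ (y (k + 1)) = (-t / J (k + 1)) * φ (y k) +
          ((E - V (k + 1)) / J (k + 1)) * φ (σ .a (y k)) := by
        field_simp
        linear_combination -f2
      ext i
      fin_cases i
      · simpa [A, Φ, Matrix.mulVec, dotProduct, Fin.sum_univ_two] using g0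
      · have g1 : φ (σ .a (y (k + 1))) = (-(E - V (k + 1)) / J (k + 1)) * φ (y k) +
            ((E - V (k + 1)) ^ 2 / (t * J (k + 1)) - J (k + 1) / t) * φ (σ .a (y k)) := by
          have : φ (σ .a (y (k + 1))) =
              ((E - V (k + 1)) * φ (y (k + 1)) - J (k + 1) * φ (σ .a (y k))) / t := by
            field_simp
            linear_combination -f1
          rw [this, g0]
          field_simp
          ring
        simpa [A, Φ, Matrix.mulVec, dotProduct, Fin.sum_univ_two] using g1
    · rw [tendsto_pi_nhds]
      intro i
      fin_cases i
      · exact tendsto_cofinite_of_lp φ hinj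
      · exact tendsto_cofinite_of_lp φ
          ((Function.LeftInverse.injective (hσ.invol .a)).comp hinj)
    · intro M
      obtain ⟨P, hMP, hP⟩ := hper M
      refine ⟨P, hMP, fun k hk hk' => ?_⟩
      have := hP (k + 1) (by omega) (by omega)
      simp only [A, hV, hJ, show k + P + 1 = k + 1 + P by ring, ← this]
  -- The line passes through every vertex, because the graph is connected.
  have cover : ∀ p, ∃ k, p = y k ∨ p = σ .a (y k) := by
    intro p
    induction Γ.connected (y 0) p with
    | refl => exact ⟨0, Or.inl rfl⟩
    | @tail q r _ hstep ih =>
      obtain ⟨s, hs⟩ := hstep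
      rw [hΓ] at hs
      subst hs
      obtain ⟨k, rfl | rfl⟩ := ih
      · by_cases hsa : s = .a
        · exact ⟨k, Or.inr (by rw [hsa])⟩
        · rcases hσ.apply_eq (y k) s hsa with h | h
          · exact ⟨k, Or.inl h⟩
          · exact ⟨k - 1, Or.inr (by rw [h, ← ha, sub_add_cancel])⟩
      · by_cases hsa : s = .a
        · exact ⟨k, Or.inl (by rw [hsa, hσ.invol])⟩
        · rcases hσ.apply_eq (σ .a (y k)) s hsa with h | h
          · exact ⟨k, Or.inr h⟩
          · exact ⟨k + 1, Or.inl (by rw [h, hy])⟩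
  ext p
  obtain ⟨k, rfl | rfl⟩ := cover p
  · exact congrFun (hΦ0 k) 0
  · exact congrFun (hΦ0 k) 1

/-! ### Periodic blocks in the ruler sequence -/

theorem ExactTwoPow.ne_zero {i : ℕ} {n : ℤ} (h : ExactTwoPow i n) : n ≠ 0 := by
  rintro rfl
  exact h.2 (dvd_zero _)

/-- If the ruler sequence around the centre `c` is interrupted only at `c` itself, and the label at
`c` agrees with `loopLabel n`, then the sequence has period `2 ^ n` around `c`. -/
theorem periodic_around_center {l : ℤ → GLabel} {n : ℕ} {c : ℤ}
    (h : ∀ j i, |j| < 2 * 2 ^ n → ExactTwoPow i j → l (c + j) = loopLabel i)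
    (h0 : l c = loopLabel n) {j : ℤ} (hj : -(2 * 2 ^ n) < j) (hj' : j < 2 ^ n) :
    l (c + j) = l (c + (j + 2 ^ n)) := by
  have hpos : (0 : ℤ) < 2 ^ n := by positivity
  by_cases hd : (2 : ℤ) ^ n ∣ j
  · have hp := h (2 ^ n) n (by rw [abs_of_pos hpos]; linarith) (ExactTwoPow.two_pow n)
    have hm := h (-2 ^ n) n (by rw [abs_neg, abs_of_pos hpos]; linarith) (ExactTwoPow.two_pow n).neg
    obtain ⟨m, rfl⟩ := hd
    have hm1 : -2 < m := by nlinarith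
    have hm2 : m < 1 := by nlinarith
    obtain rfl | rfl : m = -1 ∨ m = 0 := by omega
    · rw [mul_neg_one, neg_add_cancel, add_zero, hm, h0]
    · rw [mul_zero, zero_add, add_zero, hp, h0]
  · obtain ⟨i, hi, hij⟩ := ExactTwoPow.exists_lt hd
    rw [h j i (by rw [abs_lt]; constructor <;> linarith) hij,
      h (j + 2 ^ n) i (by rw [abs_lt]; constructor <;> linarith)
        (hij.add (pow_dvd_pow 2 hi))]

theorem exists_center {n : ℕ} {h : ℤ} (hh : h / 2 ^ n % 16 = 8) :
    ∃ i : ℤ, 0 ≤ i ∧ i < 2 ^ n ∧ ExactTwoPow (n + 3) (h - i) := by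
  have hpos : (0 : ℤ) < 2 ^ n := by positivity
  refine ⟨h % 2 ^ n, Int.emod_nonneg _ hpos.ne', Int.emod_lt_of_pos _ hpos, ?_⟩
  have h1 : h - h % 2 ^ n = 2 ^ n * (h / 2 ^ n) := by
    have := Int.mul_ediv_add_emod h (2 ^ n)
    linarith
  rw [h1]
  have e3 : (2 : ℤ) ^ (n + 3) = 2 ^ n * 8 := by rw [pow_add]; norm_num
  have e4 : (2 : ℤ) ^ (n + 3 + 1) = 2 ^ n * 16 := by rw [add_assoc, pow_add]; norm_num
  constructor
  · rw [e3]
    exact mul_dvd_mul_left _ (by omega)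
  · rw [e4, mul_dvd_mul_iff_left hpos.ne']
    omega

/-- If the four binary digits of the address starting from digit `n` are `0, 0, 0, 1` (from the
lowest to the highest) for infinitely many `n`, then there are no eigenvalues: close to the root
there is then a position with valuation `n + 3`, whose label is the same as for valuation `n`. -/
theorem noEigenvalues_of_address {Γ : LGraph} {σ : GLabel → Γ.V → Γ.V} (hΓ : Γ.Represents σ)
    (hσ : IsKleinSystem σ) {p : Γ.V}
    (hp : ∀ M : ℕ, ∃ n, M ≤ n ∧ ∃ h : ℤ, HasAddress σ p (n + 4) h ∧ h / 2 ^ n % 16 = 8)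
    {t u v w : ℝ} (ht : t ≠ 0) (huv : u + v ≠ 0) (huw : u + w ≠ 0) (hvw : v + w ≠ 0) :
    Γ.NoEigenvalues t u v w := by
  have hinj : Function.Injective (line σ p) := HasAddress.line_injective hσ fun N => by
    obtain ⟨n, hn, h, hh, -⟩ := hp N
    exact ⟨h, hh.mono (by omega)⟩
  have hl : ∀ k, ∃ l, IsLoopLabel σ l (line σ p k) := by
    intro k
    obtain ⟨n, hn, h, hh, h8⟩ := hp k.natAbs
    obtain ⟨i, hi0, hi, hex⟩ := exists_center h8
    have hk : |k| < 2 ^ n := by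
      have : n < 2 ^ n := Nat.lt_two_pow_self
      have h2 : (n : ℤ) < 2 ^ n := by exact_mod_cast this
      have h3 : |k| ≤ n := by rw [Int.abs_eq_natAbs]; exact_mod_cast hn
      exact h3.trans_lt h2
    have hnd : ¬ (2 : ℤ) ^ (n + 4) ∣ h + k := by
      intro hd
      have e : h + k = (h - i) + (k + i) := by ring
      rw [abs_lt] at hk
      have h1 : (2 : ℤ) ^ (n + 3) ∣ k + i := by
        have := (pow_dvd_pow (2 : ℤ) (show n + 3 ≤ n + 4 by omega)).trans hd
        rw [e] at this
        exact (dvd_add_right hex.1).1 this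
      have h2 : k + i = 0 := by
        refine Int.eq_zero_of_abs_lt_dvd h1 ?_
        rw [abs_lt, pow_add]
        constructor <;> nlinarith
      rw [e, h2, add_zero] at hd
      exact hex.2 hd
    obtain ⟨j, hj, hj'⟩ := ExactTwoPow.exists_lt hnd
    exact ⟨_, hh k j hj hj'⟩
  choose l hl using hl
  refine noEigenvalues_of_line hΓ hσ (hσ.line_add_one p) hinj hl ?_ ht huv huw hvw
  intro M
  obtain ⟨n, hn, h, hh, h8⟩ := hp M
  obtain ⟨i, hi0, hi, hex⟩ := exists_center h8
  refine ⟨2 ^ n, hn.trans Nat.lt_two_pow_self.le, fun k hk hk' => ?_⟩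
  push_cast at hk ⊢
  have := periodic_around_center (l := l) (n := n) (c := -i) ?_ ?_ (j := k + i) (by linarith)
    (by linarith)
  · rwa [show -i + (k + i) = k by ring, show -i + (k + i + 2 ^ n) = k + 2 ^ n by ring] at this
  · intro j m hj hm
    -- A number with absolute value less than `2 ^ (n + 1)` has valuation at most `n`.
    have hmn : m < n + 1 := by
      by_contra hmn
      refine hm.ne_zero (Int.eq_zero_of_abs_lt_dvd ((pow_dvd_pow 2 (not_lt.1 hmn)).trans hm.1) ?_)
      rwa [pow_succ']
    refine (hl _).unique (hh _ m (by omega) ?_)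
    rw [show h + (-i + j) = j + (h - i) by ring]
    exact hm.add ((pow_dvd_pow 2 (by omega)).trans hex.1)
  · rw [← loopLabel_add_three]
    exact (hl _).unique (hh _ (n + 3) (by omega) hex)

/-! ### Local convergence and the closure of the set of Schreier graphs -/

namespace RGraph

theorem ball_mono (Γ : RGraph) {m n : ℕ} (h : m ≤ n) : Γ.ball m ⊆ Γ.ball n := by
  induction h with
  | refl => exact subset_rfl
  | step _ ih => exact ih.trans Set.subset_union_left

theorem root_mem_ball (Γ : RGraph) (n : ℕ) : Γ.root ∈ Γ.ball n :=
  Γ.ball_mono (Nat.zero_le n) rfl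

theorem mem_ball_succ {Γ : RGraph} {n : ℕ} {p q : Γ.V} {s : GLabel} (hp : p ∈ Γ.ball n)
    (h : Γ.Adj s p q) : q ∈ Γ.ball (n + 1) := Or.inr ⟨p, hp, s, h⟩

theorem exists_mem_ball (Γ : RGraph) (p : Γ.V) : ∃ n, p ∈ Γ.ball n := by
  induction Γ.connected Γ.root p with
  | refl => exact ⟨0, rfl⟩
  | tail _ hstep ih =>
    obtain ⟨n, hn⟩ := ih
    obtain ⟨s, hs⟩ := hstep
    exact ⟨n + 1, mem_ball_succ hn hs⟩

theorem BallIso.symm {Γ Δ : RGraph} {r : ℕ} (h : Γ.BallIso Δ r) : Δ.BallIso Γ r := by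
  obtain ⟨e, h1, h2⟩ := h
  refine ⟨e.symm, fun p => ?_, fun s p q => ?_⟩
  · simpa using (h1 (e.symm p)).symm
  · simpa using (h2 s (e.symm p) (e.symm q)).symm

theorem BallIso.trans {Γ Δ Λ : RGraph} {r : ℕ} (h : Γ.BallIso Δ r) (h' : Δ.BallIso Λ r) :
    Γ.BallIso Λ r := by
  obtain ⟨e, h1, h2⟩ := h
  obtain ⟨f, h3, h4⟩ := h'
  exact ⟨e.trans f, fun p => (h1 p).trans (h3 _), fun s p q => (h2 s p q).trans (h4 s _ _)⟩

theorem Iso.ballIso {Γ Δ : RGraph} (h : Γ.Iso Δ) (r : ℕ) : Γ.BallIso Δ r := by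
  obtain ⟨e, hr, ha⟩ := h
  have key : ∀ n p, p ∈ Γ.ball n ↔ e p ∈ Δ.ball n := by
    intro n
    induction n with
    | zero =>
      intro p
      simp [RGraph.ball, ← hr]
    | succ n ih =>
      intro p
      simp only [RGraph.ball, Set.mem_union, ih p, Set.mem_ofPred_eq, ha]
      refine or_congr Iff.rfl ⟨?_, ?_⟩
      · rintro ⟨q, hq, s, hs⟩
        exact ⟨e q, (ih q).1 hq, s, hs⟩
      · rintro ⟨q, hq, s, hs⟩
        exact ⟨e.symm q, (ih _).2 (by simpa using hq), s, by simpa using hs⟩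
  refine ⟨e.subtypeEquiv (key r), fun p => ?_, fun s p q => ha s p q⟩
  simp [← hr]

theorem iso_of_cls_eq {Γ Δ : RGraph} (h : Γ.cls = Δ.cls) : Γ.Iso Δ := Quotient.exact h

theorem isOpen_ballIso (Γ : RGraph) (r : ℕ) :
    IsOpen {y : GraphSpace | ∃ Δ : RGraph, Δ.cls = y ∧ Γ.BallIso Δ r} :=
  TopologicalSpace.isOpen_generateFrom_of_mem ⟨Γ, r, rfl⟩

theorem exists_ballIso {Γ : RGraph} (h : Γ.cls ∈ closure (Set.range schreierMap)) (r : ℕ) :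
    ∃ ξ, Γ.BallIso (rootedSchreierGraph ξ) r := by
  obtain ⟨_, ⟨Δ, hΔ, hb⟩, ξ, rfl⟩ := mem_closure_iff.1 h _ (Γ.isOpen_ballIso r)
    ⟨Γ, rfl, Equiv.refl _, fun _ => Iff.rfl, fun _ _ _ => Iff.rfl⟩
  exact ⟨ξ, hb.trans ((iso_of_cls_eq hΔ).ballIso r)⟩

/-- `E` identifies the ball of radius `r` around the root of `Γ` with the ball of radius `r` around
`ξ` in its orbital Schreier graph. -/
structure Models (Γ : RGraph) (ξ : TreeBoundary) (r : ℕ) (E : Γ.V → TreeBoundary) : Prop where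
  root : E Γ.root = ξ
  injOn : Set.InjOn E (Γ.ball r)
  exists_adj : ∀ n < r, ∀ p ∈ Γ.ball n, ∀ s, ∃ q, Γ.Adj s p q
  adj : ∀ n < r, ∀ p ∈ Γ.ball n, ∀ s q, Γ.Adj s p q → E q = genFun s (E p)

open Classical in
theorem BallIso.exists_models {Γ : RGraph} {ξ : TreeBoundary} {r : ℕ}
    (h : Γ.BallIso (rootedSchreierGraph ξ) r) : ∃ E, Γ.Models ξ r E := by
  set Δ := rootedSchreierGraph ξ with hΔ
  obtain ⟨e, h1, h2⟩ := h
  let val : Δ.V → TreeBoundary := fun p => p.1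
  have hval : Function.Injective val := fun p q h => Subtype.ext h
  have hadj : ∀ s (p q : Δ.V), Δ.Adj s p q ↔ gen s (val p) = val q := fun _ _ _ => Iff.rfl
  let E : Γ.V → TreeBoundary := fun p => if hp : p ∈ Γ.ball r then val (e ⟨p, hp⟩) else ξ
  have hE : ∀ p (hp : p ∈ Γ.ball r), E p = val (e ⟨p, hp⟩) := fun p hp => dif_pos hp
  have hball : ∀ n ≤ r, ∀ p (hp : p ∈ Γ.ball r), p ∈ Γ.ball n → (e ⟨p, hp⟩ : Δ.V) ∈ Δ.ball n := by
    intro n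
    induction n with
    | zero =>
      intro _ p hp h0
      exact (h1 ⟨p, hp⟩).1 h0
    | succ n ih =>
      rintro hn p hp (h0 | ⟨q, hq, s, hs⟩)
      · exact Or.inl (ih (by omega) p hp h0)
      · have hqr := Γ.ball_mono (by omega : n ≤ r) hq
        exact Or.inr ⟨_, ih (by omega) q hqr hq, s, (h2 s ⟨q, hqr⟩ ⟨p, hp⟩).1 hs⟩
  refine ⟨E, ?_, ?_, ?_, ?_⟩
  · rw [hE _ (Γ.root_mem_ball r), (h1 ⟨Γ.root, Γ.root_mem_ball r⟩).1 rfl]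
    rfl
  · intro p hp q hq hpq
    rw [hE p hp, hE q hq] at hpq
    exact congrArg Subtype.val (e.injective (Subtype.ext (hval hpq)))
  · intro n hn p hp s
    have hpr := Γ.ball_mono hn.le hp
    let p' : MulAction.orbit GrigorchukGroup ξ := (e ⟨p, hpr⟩ : Δ.V)
    let q : Δ.V := (⟨gen s, gen_mem s⟩ : GrigorchukGroup) • p'
    have hq : Δ.Adj s (e ⟨p, hpr⟩ : Δ.V) q := rfl
    have hqr : q ∈ Δ.ball r := Δ.ball_mono hn (mem_ball_succ (hball n hn.le p hpr hp) hq)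
    refine ⟨(e.symm ⟨q, hqr⟩ : Γ.V), (h2 s ⟨p, hpr⟩ (e.symm ⟨q, hqr⟩)).2 ?_⟩
    rw [e.apply_symm_apply]
    exact hq
  · intro n hn p hp s q hs
    have hpr := Γ.ball_mono hn.le hp
    have hqr := Γ.ball_mono hn (mem_ball_succ hp hs)
    rw [hE p hpr, hE q hqr]
    exact ((hadj _ _ _).1 ((h2 s ⟨p, hpr⟩ ⟨q, hqr⟩).1 hs)).symm

/-- Every graph in the closure of the set of Schreier graphs carries a Klein system, since the
defining properties can be checked in finite balls. -/
theorem exists_isKleinSystem {Γ : RGraph} (h : Γ.cls ∈ closure (Set.range schreierMap)) :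
    ∃ σ, Γ.Represents σ ∧ IsKleinSystem σ := by
  have hm : ∀ r, ∃ ξ E, Γ.Models ξ r E := fun r => by
    obtain ⟨ξ, hξ⟩ := exists_ballIso h r
    exact ⟨ξ, hξ.exists_models⟩
  have hex : ∀ s p, ∃ q, Γ.Adj s p q := fun s p => by
    obtain ⟨n, hn⟩ := Γ.exists_mem_ball p
    obtain ⟨ξ, E, hE⟩ := hm (n + 1)
    exact hE.exists_adj n (by omega) p hn s
  choose σ hσ using hex
  have hrep : Γ.Represents σ := by
    intro s p q
    refine ⟨fun hq => ?_, fun hq => hq ▸ hσ s p⟩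
    obtain ⟨n, hn⟩ := Γ.exists_mem_ball p
    obtain ⟨ξ, E, hE⟩ := hm (n + 1)
    refine hE.injOn (mem_ball_succ hn (hσ s p)) (mem_ball_succ hn hq) ?_
    rw [hE.adj n (by omega) p hn s q hq, hE.adj n (by omega) p hn s _ (hσ s p)]
  refine ⟨σ, hrep, fun s p => ?_, fun p => ?_, fun p => ?_⟩
  · exact (hrep _ _ _).1 (Γ.symm _ _ _ (hσ s p))
  all_goals
    obtain ⟨n, hn⟩ := Γ.exists_mem_ball p
    obtain ⟨ξ, E, hE⟩ := hm (n + 2)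
    have hs : ∀ s, E (σ s p) = genFun s (E p) := fun s =>
      hE.adj n (by omega) p hn s _ (hσ s p)
    have hb : ∀ s, σ s p ∈ Γ.ball (n + 1) := fun s => mem_ball_succ hn (hσ s p)
    have hb2 : ∀ s, σ s p ∈ Γ.ball (n + 2) := fun s => Γ.ball_mono (by omega) (hb s)
    have hp2 : p ∈ Γ.ball (n + 2) := Γ.ball_mono (by omega) hn
  · refine hE.injOn (mem_ball_succ (hb .c) (hσ .b _)) (hb2 .d) ?_
    rw [hE.adj (n + 1) (by omega) _ (hb .c) .b _ (hσ .b _), hs, hs, isKleinSystem_genFun.klein]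
  · have hfix : ∀ s, genFun s (E p) = E p → σ s p = p := fun s h' =>
      hE.injOn (hb2 s) hp2 (by rw [hs, h'])
    exact (isKleinSystem_genFun.fixed (E p)).imp (hfix _) (Or.imp (hfix _) (hfix _))

end RGraph

/-- The part of `HasAddress` that concerns the vertices with numbers `2k`, `|k| ≤ m`, of the
line. -/
def HasAddressWithin {V : Type} (σ : GLabel → V → V) (p : V) (N : ℕ) (h : ℤ) (m : ℕ) : Prop :=
  ∀ (k : ℤ), k.natAbs ≤ m → ∀ i : ℕ, i < N → ExactTwoPow i (h + k) →
    IsLoopLabel σ (loopLabel i) (line σ p k)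

namespace RGraph.Models

variable {Γ : RGraph} {σ : GLabel → Γ.V → Γ.V} {ξ : TreeBoundary} {r : ℕ} {E : Γ.V → TreeBoundary}

theorem map_apply (hE : Γ.Models ξ r E) (hσ : Γ.Represents σ) {n : ℕ} (hn : n < r) {p : Γ.V}
    (hp : p ∈ Γ.ball n) (s : GLabel) : E (σ s p) = genFun s (E p) :=
  hE.adj n hn p hp s _ ((hσ s p _).2 rfl)

theorem apply_eq_iff (hE : Γ.Models ξ r E) (hσ : Γ.Represents σ) {n : ℕ} (hn : n < r) {p : Γ.V}
    (hp : p ∈ Γ.ball n) (s : GLabel) : σ s p = p ↔ genFun s (E p) = E p := by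
  rw [← hE.map_apply hσ hn hp]
  exact (hE.injOn.eq_iff (Γ.ball_mono hn (mem_ball_succ hp ((hσ s p _).2 rfl)))
    (Γ.ball_mono hn.le hp)).symm

theorem map_pairMove (hE : Γ.Models ξ r E) (hσ : Γ.Represents σ) {n : ℕ} (hn : n < r) {p : Γ.V}
    (hp : p ∈ Γ.ball n) : E (pairMove σ p) = pairMove genFun (E p) := by
  unfold pairMove
  by_cases hb : σ .b p = p
  · rw [if_pos hb, if_pos ((hE.apply_eq_iff hσ hn hp .b).1 hb), hE.map_apply hσ hn hp]
  · rw [if_neg hb, if_neg fun h' => hb ((hE.apply_eq_iff hσ hn hp .b).2 h'),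
      hE.map_apply hσ hn hp]

theorem isLoopLabel_iff (hE : Γ.Models ξ r E) (hσ : Γ.Represents σ) {n : ℕ} (hn : n < r) {p : Γ.V}
    (hp : p ∈ Γ.ball n) (l : GLabel) : IsLoopLabel σ l p ↔ IsLoopLabel genFun l (E p) := by
  simp only [IsLoopLabel, hE.apply_eq_iff hσ hn hp]

theorem pairMove_mem_ball (hσ : Γ.Represents σ) {n : ℕ} {p : Γ.V} (hp : p ∈ Γ.ball n) :
    pairMove σ p ∈ Γ.ball (n + 1) := by
  obtain ⟨s, -, h⟩ := IsKleinSystem.pairMove_cases (σ := σ) p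
  rw [h]
  exact mem_ball_succ hp ((hσ s p _).2 rfl)

theorem map_line (hE : Γ.Models ξ r E) (hσ : Γ.Represents σ) (hK : IsKleinSystem σ) (m : ℕ)
    (hm : 2 * m ≤ r) :
    (line σ Γ.root m ∈ Γ.ball (2 * m) ∧ E (line σ Γ.root m) = line genFun ξ m) ∧
      line σ Γ.root (-m) ∈ Γ.ball (2 * m) ∧ E (line σ Γ.root (-m)) = line genFun ξ (-m) := by
  induction m with
  | zero => simp [line_zero, hE.root, RGraph.ball]
  | succ m ih =>
    obtain ⟨⟨h1, h2⟩, h3, h4⟩ := ih (by omega)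
    push_cast
    have ha : ∀ {n : ℕ} {p : Γ.V}, p ∈ Γ.ball n → σ .a p ∈ Γ.ball (n + 1) := fun hp =>
      mem_ball_succ hp ((hσ .a _ _).2 rfl)
    rw [neg_add, ← sub_eq_add_neg, hK.line_add_one, hK.line_sub_one,
      isKleinSystem_genFun.line_add_one, isKleinSystem_genFun.line_sub_one]
    refine ⟨⟨pairMove_mem_ball hσ (ha h1), ?_⟩, ha (pairMove_mem_ball hσ h3), ?_⟩
    · rw [hE.map_pairMove hσ (n := 2 * m + 1) (by omega) (ha h1),
        hE.map_apply hσ (n := 2 * m) (by omega) h1, h2]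
    · rw [hE.map_apply hσ (n := 2 * m + 1) (by omega) (pairMove_mem_ball hσ h3),
        hE.map_pairMove hσ (n := 2 * m) (by omega) h3, h4]

theorem hasAddressWithin_iff {m : ℕ} (hE : Γ.Models ξ (2 * m + 1) E) (hσ : Γ.Represents σ)
    (hK : IsKleinSystem σ) (N : ℕ) (h : ℤ) :
    HasAddressWithin σ Γ.root N h m ↔ HasAddressWithin genFun ξ N h m := by
  have key : ∀ k : ℤ, k.natAbs ≤ m → ∀ l, IsLoopLabel σ l (line σ Γ.root k) ↔
      IsLoopLabel genFun l (line genFun ξ k) := by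
    intro k hk l
    obtain ⟨h1, h2⟩ := hE.map_line hσ hK k.natAbs (by omega)
    rcases Int.natAbs_eq k with hk' | hk'
    · rw [hk', hE.isLoopLabel_iff hσ (n := 2 * k.natAbs) (by omega) h1.1, h1.2]
    · rw [hk', hE.isLoopLabel_iff hσ (n := 2 * k.natAbs) (by omega) h2.1, h2.2]
  unfold HasAddressWithin
  refine forall_congr' fun k => forall_congr' fun hk => ?_
  simp only [key k hk]

end RGraph.Models

/-- Every graph in the closure of the set of Schreier graphs has an address modulo `2 ^ N`. Each
finite part of the line has one, because it looks like a part of an orbital Schreier graph, and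
there are only finitely many residues. -/
theorem RGraph.exists_hasAddress {Γ : RGraph} (h : Γ.cls ∈ closure (Set.range schreierMap))
    {σ : GLabel → Γ.V → Γ.V} (hσ : Γ.Represents σ) (hK : IsKleinSystem σ) (N : ℕ) :
    ∃ h, HasAddress σ Γ.root N h := by
  have key : ∀ m, ∃ h ∈ Finset.Ico (0 : ℤ) (2 ^ N), HasAddressWithin σ Γ.root N h m := by
    intro m
    obtain ⟨ξ, hξ⟩ := exists_ballIso h (2 * m + 1)
    obtain ⟨E, hE⟩ := hξ.exists_models
    have hpos : (0 : ℤ) < 2 ^ N := by positivity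
    refine ⟨address N ξ % 2 ^ N, Finset.mem_Ico.2 ⟨Int.emod_nonneg _ hpos.ne',
      Int.emod_lt_of_pos _ hpos⟩, (hE.hasAddressWithin_iff hσ hK N _).2 fun k _ => ?_⟩
    refine ((hasAddress_genFun N ξ).congr ?_) k
    rw [dvd_sub_comm]
    exact Int.dvd_self_sub_emod
  by_contra hno
  push Not at hno
  have hbad : ∀ h : ℤ, ∃ m, ¬ HasAddressWithin σ Γ.root N h m := by
    intro h
    by_contra hc
    push Not at hc
    exact hno h fun k => hc k.natAbs k le_rfl
  choose f hf using hbad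
  obtain ⟨h, hh, hw⟩ := key ((Finset.Ico (0 : ℤ) (2 ^ N)).sup f)
  exact hf h fun k hk => hw k (hk.trans (Finset.le_sup hh))

/-! ### Almost every address has infinitely many good blocks of digits -/

/-- The number of residues modulo `16 ^ (M + L)` without the hexadecimal digit `8` at the places
`M, …, M + L - 1`. -/
theorem card_filter_digit_le (M L : ℕ) :
    ((Finset.range (16 ^ (M + L))).filter
      fun h => ∀ m, M ≤ m → m < M + L → h / 16 ^ m % 16 ≠ 8).card ≤ 16 ^ M * 15 ^ L := by
  induction L with
  | zero =>
    refine (Finset.card_filter_le _ _).trans ?_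
    simp
  | succ L ih =>
    have hcard : ((Finset.range 16).erase 8).card = 15 := by decide
    rw [pow_succ, ← mul_assoc]
    refine le_trans ?_ (Nat.mul_le_mul_right 15 ih)
    rw [← hcard, ← Finset.card_product]
    have hpos : 0 < 16 ^ (M + L) := by positivity
    refine Finset.card_le_card_of_injOn (fun h => (h % 16 ^ (M + L), h / 16 ^ (M + L))) ?_ ?_
    · intro h hh
      simp only [Finset.coe_filter, Finset.mem_range, Set.mem_ofPred_eq] at hh
      simp only [Finset.coe_product, Set.mem_prod, Finset.coe_filter, Finset.mem_range,
        Set.mem_ofPred_eq, Finset.coe_erase, Set.mem_sdiff, Finset.mem_coe, Set.mem_singleton_iff]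
      have hlt : h / 16 ^ (M + L) < 16 := by
        rw [Nat.div_lt_iff_lt_mul hpos, mul_comm, ← pow_succ]
        exact hh.1
      refine ⟨⟨Nat.mod_lt _ hpos, fun m hm hm' => ?_⟩, hlt, fun h8 => ?_⟩
      · have h1 : h % 16 ^ (M + L) / 16 ^ m % 16 = h / 16 ^ m % 16 := by
          rw [show M + L = m + (M + L - m) by omega, pow_add, Nat.mod_mul_right_div_self]
          exact Nat.mod_mod_of_dvd _ (dvd_pow_self 16 (by omega))
        rw [h1]
        exact hh.2 m hm (by omega)
      · refine hh.2 (M + L) (by omega) (by omega) ?_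
        rw [h8]
    · intro h _ h' _ heq
      simp only [Prod.mk.injEq] at heq
      rw [← Nat.div_add_mod h (16 ^ (M + L)), ← Nat.div_add_mod h' (16 ^ (M + L)), heq.1, heq.2]

/-- If the residues modulo `2 ^ N` of a random address have at most the probabilities of the uniform
distribution, then almost surely the digit `8` occurs at infinitely many places of its hexadecimal
expansion. -/
theorem ae_exists_digit_eq {Ω : Type*} [MeasurableSpace Ω] {ν : Measure Ω} {A : ℕ → ℕ → Set Ω}
    (hA : ∀ N h, ν (A N h) ≤ (2 ^ N)⁻¹) (hcov : ∀ᵐ x ∂ν, ∀ N, ∃ h < 2 ^ N, x ∈ A N h) :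
    ∀ᵐ x ∂ν, ∀ M, ∃ N h m, M ≤ m ∧ 4 * m + 4 ≤ N ∧ x ∈ A N h ∧ h / 16 ^ m % 16 = 8 := by
  rw [ae_all_iff]
  intro M
  -- The set of points where the digit `8` does not occur at any place from `M` on.
  set bad : Set Ω := {x | (∀ N, ∃ h < 2 ^ N, x ∈ A N h) ∧
    ¬ ∃ N h m, M ≤ m ∧ 4 * m + 4 ≤ N ∧ x ∈ A N h ∧ h / 16 ^ m % 16 = 8} with hbad
  have key : ∀ L : ℕ, ν bad ≤ (15 / 16) ^ L := by
    intro L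
    set S := (Finset.range (16 ^ (M + L))).filter
      fun h => ∀ m, M ≤ m → m < M + L → h / 16 ^ m % 16 ≠ 8 with hS
    have hsub : bad ⊆ ⋃ h ∈ S, A (4 * (M + L)) h := by
      rintro x ⟨h1, h2⟩
      obtain ⟨h, hh, hx⟩ := h1 (4 * (M + L))
      simp only [Set.mem_iUnion]
      refine ⟨h, Finset.mem_filter.2 ⟨Finset.mem_range.2 ?_, fun m hm hm' h8 => h2 ?_⟩, hx⟩
      · rwa [pow_mul] at hh
      · exact ⟨_, h, m, hm, by omega, hx, h8⟩
    calc ν bad ≤ ∑ h ∈ S, ν (A (4 * (M + L)) h) :=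
          (measure_mono hsub).trans (measure_biUnion_finset_le _ _)
      _ ≤ ∑ _h ∈ S, (2 ^ (4 * (M + L)))⁻¹ := Finset.sum_le_sum fun h _ => hA _ h
      _ = S.card * (2 ^ (4 * (M + L)))⁻¹ := by rw [Finset.sum_const, nsmul_eq_mul]
      _ ≤ (16 ^ M * 15 ^ L : ℕ) * (2 ^ (4 * (M + L)))⁻¹ := by
          gcongr
          exact card_filter_digit_le M L
      _ ≤ (15 / 16) ^ L := by
          rw [← div_eq_mul_inv, pow_mul]
          refine ENNReal.div_le_of_le_mul ?_
          rw [show (2 : ENNReal) ^ 4 = 16 by norm_num, pow_add, mul_left_comm, ← mul_pow,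
            ENNReal.div_mul_cancel (by norm_num) (by norm_num)]
          push_cast
          exact le_rfl
  have hzero : ν bad = 0 := by
    have hlim : Filter.Tendsto (fun L : ℕ => (15 / 16 : ENNReal) ^ L) Filter.atTop (nhds 0) :=
      ENNReal.tendsto_pow_atTop_nhds_zero_of_lt_one (by
        rw [ENNReal.div_lt_iff (by norm_num) (by norm_num)]
        norm_num)
    exact le_antisymm (ge_of_tendsto' hlim key) zero_le
  have hae : ∀ᵐ x ∂ν, x ∉ bad := measure_eq_zero_iff_ae_notMem.1 hzero
  filter_upwards [hcov, hae] with x hx hx'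
  by_contra hno
  exact hx' ⟨hx, hno⟩

/-- The criterion `noEigenvalues_of_address` at the scales `n = 4 m`, at which the four digits that
matter form a hexadecimal digit. -/
theorem noEigenvalues_of_digits {Γ : LGraph} {σ : GLabel → Γ.V → Γ.V} (hΓ : Γ.Represents σ)
    (hσ : IsKleinSystem σ) {p : Γ.V}
    (hp : ∀ M : ℕ, ∃ N h m : ℕ, M ≤ m ∧ 4 * m + 4 ≤ N ∧ HasAddress σ p N h ∧ h / 16 ^ m % 16 = 8)
    {t u v w : ℝ} (ht : t ≠ 0) (huv : u + v ≠ 0) (huw : u + w ≠ 0) (hvw : v + w ≠ 0) :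
    Γ.NoEigenvalues t u v w := by
  refine noEigenvalues_of_address hΓ hσ (p := p) (fun M => ?_) ht huv huw hvw
  obtain ⟨N, h, m, hm, hN, hh, h8⟩ := hp M
  refine ⟨4 * m, by omega, h, hh.mono (by omega), ?_⟩
  rw [pow_mul]
  exact_mod_cast h8

/-! ### Uniform distribution of the address under the Bernoulli measure -/

/-- The residue of the address modulo `2 ^ N` determines the first `N` digits of the word. -/
theorem exists_word_of_address (N : ℕ) (h : ℤ) :
    ∃ w : ℕ → Bool, ∀ ξ, (2 : ℤ) ^ N ∣ address N ξ - h → ∀ i < N, ξ i = w i := by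
  induction N generalizing h with
  | zero => exact ⟨fun _ => true, fun _ _ i hi => absurd hi (Nat.not_lt_zero i)⟩
  | succ N ih =>
    have h2 : (2 : ℤ) ∣ 2 ^ (N + 1) := dvd_pow_self 2 (by omega)
    rcases Int.even_or_odd' h with ⟨h', rfl | rfl⟩
    · obtain ⟨w, hw⟩ := ih h'
      refine ⟨fun i => Nat.casesOn i true w, fun ξ hξ i hi => ?_⟩
      have h0 : ξ 0 = true := by
        by_contra h0
        rw [address, if_neg h0] at hξ
        have := h2.trans hξ
        omega
      rw [address, if_pos h0, ← mul_sub, pow_succ',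
        mul_dvd_mul_iff_left two_ne_zero] at hξ
      rcases i with _ | i
      · exact h0
      · exact hw _ hξ i (by omega)
    · obtain ⟨w, hw⟩ := ih (-1 - h')
      refine ⟨fun i => Nat.casesOn i false w, fun ξ hξ i hi => ?_⟩
      have h0 : ¬ ξ 0 = true := by
        intro h0
        rw [address, if_pos h0] at hξ
        have := h2.trans hξ
        omega
      rw [address, if_neg h0,
        show -1 - 2 * address N ξ.tail - (2 * h' + 1) =
          2 * -(address N ξ.tail - (-1 - h')) by ring, pow_succ',
        mul_dvd_mul_iff_left two_ne_zero, dvd_neg] at hξ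
      rcases i with _ | i
      · simpa using h0
      · exact hw _ hξ i (by omega)

/-- The set is contained in a cylinder set. -/
theorem boundaryMeasure_address_le (N : ℕ) (h : ℤ) :
    boundaryMeasure {ξ | (2 : ℤ) ^ N ∣ address N ξ - h} ≤ (2 ^ N)⁻¹ := by
  obtain ⟨w, hw⟩ := exists_word_of_address N h
  have hsub : {ξ | (2 : ℤ) ^ N ∣ address N ξ - h} ⊆
      Set.pi (Finset.range N : Set ℕ) fun i => {w i} := by
    intro ξ hξ i hi
    exact hw ξ hξ i (by simpa using hi)
  refine (measure_mono hsub).trans ?_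
  rw [boundaryMeasure, Measure.infinitePi_pi _ fun i _ => MeasurableSet.singleton _]
  simp [ENNReal.inv_pow]

/-- The action of the generators on the orbit of `ξ`. -/
theorem represents_gen (ξ : TreeBoundary) :
    ∃ σ : GLabel → (orbitalSchreierGraph ξ).V → (orbitalSchreierGraph ξ).V,
      (orbitalSchreierGraph ξ).Represents σ ∧ ∀ s p, (σ s p).1 = genFun s p.1 := by
  let σ : GLabel → MulAction.orbit GrigorchukGroup ξ → MulAction.orbit GrigorchukGroup ξ :=
    fun s p => (⟨gen s, gen_mem s⟩ : GrigorchukGroup) • p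
  have hval : ∀ s p, (σ s p).1 = genFun s p.1 := fun _ _ => rfl
  have hinj : ∀ s p q, σ s p = q ↔ genFun s p.1 = q.1 := fun s p q => by
    rw [Subtype.ext_iff, hval]
  exact ⟨σ, fun s p q => (hinj s p q).symm, hval⟩

theorem ae_noEigenvalues_orbital {t u v w : ℝ} (ht : t ≠ 0) (huv : u + v ≠ 0) (huw : u + w ≠ 0)
    (hvw : v + w ≠ 0) :
    ∀ᵐ ξ ∂boundaryMeasure, (orbitalSchreierGraph ξ).NoEigenvalues t u v w := by
  have hdig := ae_exists_digit_eq (ν := boundaryMeasure)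
    (A := fun N h => {ξ | (2 : ℤ) ^ N ∣ address N ξ - h})
    (fun N h => boundaryMeasure_address_le N h) (Filter.Eventually.of_forall fun ξ N => by
      have hpos : (0 : ℤ) < 2 ^ N := by positivity
      have h0 := Int.emod_nonneg (address N ξ) hpos.ne'
      have h1 := Int.emod_lt_of_pos (address N ξ) hpos
      refine ⟨(address N ξ % 2 ^ N).toNat, ?_, ?_⟩
      · zify
        rwa [Int.toNat_of_nonneg h0]
      · change (2 : ℤ) ^ N ∣ address N ξ - (address N ξ % 2 ^ N).toNat
        rw [Int.toNat_of_nonneg h0]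
        exact Int.dvd_self_sub_emod)
  filter_upwards [hdig] with ξ hξ
  obtain ⟨σ, hrep, hval⟩ := represents_gen ξ
  have hσ := isKleinSystem_genFun.of_injective Subtype.val_injective hval
  refine noEigenvalues_of_digits hrep hσ (p := (rootedSchreierGraph ξ).root) (fun M => ?_)
    ht huv huw hvw
  obtain ⟨N, h, m, hm, hN, hh, h8⟩ := hξ M
  refine ⟨N, h, m, hm, hN, ?_, h8⟩
  refine HasAddress.of_injective isKleinSystem_genFun Subtype.val_injective hval ?_
  exact (hasAddress_genFun N ξ).congr (by rw [dvd_sub_comm]; exact hh)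

/-! ### Uniform distribution of the address under an invariant measure -/

theorem GraphSpace.exists_rep (x : GraphSpace) : ∃ Γ : RGraph, Γ.cls = x :=
  Quotient.exists_rep x

/-- The graphs in the closure of the set of Schreier graphs whose root has address `h` modulo
`2 ^ N`. -/
def addressSet (N : ℕ) (h : ℤ) : Set GraphSpace :=
  {x | x ∈ closure (Set.range schreierMap) ∧ ∀ (Γ : RGraph) (σ : GLabel → Γ.V → Γ.V),
    Γ.cls = x → Γ.Represents σ → HasAddress σ Γ.root N h}

/-- Within the closure, the condition on each finite part of the line is open. -/
theorem measurableSet_addressSet (N : ℕ) (h : ℤ) : MeasurableSet (addressSet N h) := by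
  have heq : addressSet N h = closure (Set.range schreierMap) ∩
      ⋂ m : ℕ, ⋃ ξ ∈ {ξ | HasAddressWithin genFun ξ N h m},
        {y | ∃ Δ : RGraph, Δ.cls = y ∧ (rootedSchreierGraph ξ).BallIso Δ (2 * m + 1)} := by
    ext x
    constructor
    · rintro ⟨hx, hall⟩
      refine ⟨hx, Set.mem_iInter.2 fun m => ?_⟩
      obtain ⟨Γ, rfl⟩ := GraphSpace.exists_rep x
      obtain ⟨σ, hσ, hK⟩ := RGraph.exists_isKleinSystem (Γ := Γ) hx
      obtain ⟨ξ, hξ⟩ := RGraph.exists_ballIso (Γ := Γ) hx (2 * m + 1)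
      obtain ⟨E, hE⟩ := hξ.exists_models
      simp only [Set.mem_iUnion]
      exact ⟨ξ, (hE.hasAddressWithin_iff hσ hK N h).1 fun k _ => hall Γ σ rfl hσ k, Γ, rfl,
        hξ.symm⟩
    · rintro ⟨hx, hall⟩
      refine ⟨hx, ?_⟩
      rintro Γ σ rfl hσ k
      obtain ⟨τ, hτ, hK⟩ := RGraph.exists_isKleinSystem hx
      obtain rfl : σ = τ := by
        funext s p
        exact ((hσ s p _).1 ((hτ s p _).2 rfl))
      have hm := Set.mem_iInter.1 hall k.natAbs
      simp only [Set.mem_iUnion] at hm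
      obtain ⟨ξ, hξ, Δ, hΔ, hb⟩ := hm
      obtain ⟨E, hE⟩ := (hb.trans ((RGraph.iso_of_cls_eq hΔ).ballIso _)).symm.exists_models
      exact (hE.hasAddressWithin_iff hσ hK N h).2 hξ k le_rfl
  rw [heq]
  exact isClosed_closure.measurableSet.inter (MeasurableSet.iInter fun m =>
    (isOpen_biUnion fun ξ _ => RGraph.isOpen_ballIso _ _).measurableSet)

/-- The graphs in the closure of the set of Schreier graphs whose root has address `h` modulo
`2 ^ N`. In contrast to `addressSet N h`, one more digit is taken into account, so that these sets
are disjoint for different residues of `h` modulo `2 ^ N`. -/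
def addressClass (N : ℕ) (h : ℤ) : Set GraphSpace :=
  ⋃ h' : {h' : ℤ // (2 : ℤ) ^ N ∣ h' - h}, addressSet (N + 1) h'

theorem mem_addressClass {N : ℕ} {h : ℤ} {x : GraphSpace} :
    x ∈ addressClass N h ↔ ∃ h', (2 : ℤ) ^ N ∣ h' - h ∧ x ∈ addressSet (N + 1) h' := by
  simp [addressClass]

theorem measurableSet_addressClass (N : ℕ) (h : ℤ) : MeasurableSet (addressClass N h) :=
  MeasurableSet.iUnion fun _ => measurableSet_addressSet _ _

theorem addressClass_congr {N : ℕ} {h k : ℤ} (hk : (2 : ℤ) ^ N ∣ h - k) :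
    addressClass N h = addressClass N k := by
  ext x
  simp only [mem_addressClass]
  refine exists_congr fun h' => and_congr_left fun _ => ?_
  rw [← dvd_add_left hk, sub_add_sub_cancel]

theorem disjoint_addressClass {N : ℕ} {h k : ℤ} (hk : ¬ (2 : ℤ) ^ N ∣ h - k) :
    Disjoint (addressClass N h) (addressClass N k) := by
  rw [Set.disjoint_left]
  intro x hx hx'
  obtain ⟨h', hh', hx, H⟩ := mem_addressClass.1 hx
  obtain ⟨k', hk', -, H'⟩ := mem_addressClass.1 hx'
  obtain ⟨Γ, rfl⟩ := GraphSpace.exists_rep x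
  obtain ⟨σ, hσ, hK⟩ := RGraph.exists_isKleinSystem (Γ := Γ) hx
  have := (H Γ σ rfl hσ).unique (H' Γ σ rfl hσ)
  refine hk ?_
  have e : h - k = (h' - k') - (h' - h) + (k' - k) := by ring
  rw [e]
  exact dvd_add (dvd_sub this hh') hk'

theorem RGraph.move_root {Γ : RGraph} {σ : GLabel → Γ.V → Γ.V} (hσ : Γ.Represents σ)
    (s : GLabel) : (Γ.move s).root = σ s Γ.root := by
  have hex : ∃! q, Γ.Adj s Γ.root q :=
    ⟨σ s Γ.root, (hσ _ _ _).2 rfl, fun q hq => ((hσ _ _ _).1 hq).symm⟩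
  have h1 : (Γ.move s).root = hex.choose := dif_pos hex
  rw [h1]
  exact ((hσ _ _ _).1 hex.choose_spec.1).symm

theorem hasAddress_apply_of_move_mem {Γ : RGraph} {σ : GLabel → Γ.V → Γ.V} (hσ : Γ.Represents σ)
    {s : GLabel} {N : ℕ} {h : ℤ} (hm : GraphSpace.move s Γ.cls ∈ addressSet N h) :
    HasAddress σ (σ s Γ.root) N h := by
  have := hm.2 (Γ.move s) σ rfl hσ
  rwa [RGraph.move_root hσ] at this

theorem mem_addressSet_of_hasAddress {Γ : RGraph} (hx : Γ.cls ∈ closure (Set.range schreierMap))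
    {σ : GLabel → Γ.V → Γ.V} (hσ : Γ.Represents σ) {N : ℕ} {h : ℤ}
    (H : HasAddress σ Γ.root N h) : Γ.cls ∈ addressSet N h := by
  refine ⟨hx, fun Δ τ hΔ hτ => ?_⟩
  obtain ⟨f, hf, ha⟩ := RGraph.iso_of_cls_eq hΔ
  obtain ⟨σ', hσ', hK⟩ := RGraph.exists_isKleinSystem hx
  obtain rfl : σ' = σ := by
    funext s p
    exact ((hσ' s p _).1 ((hσ s p _).2 rfl))
  refine HasAddress.of_injective hK f.injective (fun s p => ?_) (by rwa [hf])
  exact ((hσ _ _ _).1 ((ha _ _ _).1 ((hτ s p _).2 rfl))).symm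

section Invariant

variable {ν : Measure GraphSpace}

theorem IsInvariantOnSchreierSpace.ae_mem_closure (hν : IsInvariantOnSchreierSpace ν) :
    ∀ᵐ x ∂ν, x ∈ closure (Set.range schreierMap) := by
  rw [ae_iff]
  refine measure_mono_null ?_ hν.concentrated
  intro x hx hx'
  exact hx hx'.1

/-- By invariance it is enough that a root has address `k` whenever the generator `s` moves it to a
vertex with address `h`. -/
theorem measure_addressClass_le_of_move (hν : IsInvariantOnSchreierSpace ν) {N : ℕ} {h k : ℤ}
    (s : GLabel)
    (hs : ∀ (Γ : RGraph) (σ : GLabel → Γ.V → Γ.V), Γ.Represents σ → IsKleinSystem σ →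
      ∀ h', (2 : ℤ) ^ N ∣ h' - h → HasAddress σ (σ s Γ.root) (N + 1) h' →
        ∃ k', (2 : ℤ) ^ N ∣ k' - k ∧ HasAddress σ Γ.root (N + 1) k') :
    ν (addressClass N h) ≤ ν (addressClass N k) := by
  rw [← (hν.invariant s).measure_preimage (measurableSet_addressClass N h).nullMeasurableSet]
  refine measure_mono_ae ?_
  filter_upwards [hν.ae_mem_closure] with x hx hmem
  obtain ⟨h', hh', hm⟩ := mem_addressClass.1 hmem
  obtain ⟨Γ, rfl⟩ := GraphSpace.exists_rep x
  obtain ⟨σ, hσ, hK⟩ := RGraph.exists_isKleinSystem (Γ := Γ) hx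
  obtain ⟨k', hk', H⟩ := hs Γ σ hσ hK h' hh' (hasAddress_apply_of_move_mem hσ hm)
  exact mem_addressClass.2 ⟨k', hk', mem_addressSet_of_hasAddress hx hσ H⟩

theorem measure_addressClass_le_a (hν : IsInvariantOnSchreierSpace ν) (N : ℕ) (h : ℤ) :
    ν (addressClass N h) ≤ ν (addressClass N (-1 - h)) := by
  refine measure_addressClass_le_of_move hν .a fun Γ σ hσ hK h' hh' H => ⟨-1 - h', ?_, ?_⟩
  · rw [sub_sub_sub_cancel_left, dvd_sub_comm]
    exact hh'
  · have := H.a_move hK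
    rwa [hK.invol] at this

/-- Among `b, c, d` there is a generator that acts as `h ↦ -h` on all points with a given nonzero
residue `h` modulo `2 ^ N`. -/
theorem measure_addressClass_le_neg (hν : IsInvariantOnSchreierSpace ν) (N : ℕ) (h : ℤ) :
    ν (addressClass N h) ≤ ν (addressClass N (-h)) := by
  by_cases hN : (2 : ℤ) ^ N ∣ h
  · refine le_of_eq (congrArg ν (addressClass_congr ?_))
    rw [sub_neg_eq_add]
    exact dvd_add hN hN
  obtain ⟨i, hi, hex⟩ := ExactTwoPow.exists_lt hN
  obtain ⟨s, hs, hsl⟩ := GLabel.exists_ne (loopLabel i)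
  refine measure_addressClass_le_of_move hν s fun Γ σ hσ hK h' hh' H => ⟨-h', ?_, ?_⟩
  · rw [sub_neg_eq_add, neg_add_eq_sub, dvd_sub_comm]
    exact hh'
  · have hl := H 0 i (by omega) (by
      rw [add_zero]
      exact hex.congr hi (by rwa [dvd_sub_comm]))
    rw [line_zero] at hl
    have := H.pairMove_move hK
    rwa [← hK.pairMove_eq hl hs hsl, hK.invol] at this

/-- The composition of the reflections `h ↦ -1 - h` and `h ↦ -h` is the translation by one. -/
theorem measure_addressClass_le_add (hν : IsInvariantOnSchreierSpace ν) (N : ℕ) (h : ℤ) (m : ℕ) :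
    ν (addressClass N h) ≤ ν (addressClass N (h + m)) := by
  induction m with
  | zero => simp
  | succ m ih =>
    refine ih.trans ((measure_addressClass_le_a hν N _).trans
      ((measure_addressClass_le_neg hν N _).trans (le_of_eq ?_)))
    congr 2
    push_cast
    ring

/-- Since the translation by one permutes the residues modulo `2 ^ N` transitively, they are
uniformly distributed. -/
theorem measure_addressClass_le (hν : IsInvariantOnSchreierSpace ν) (N : ℕ) (h : ℤ) :
    ν (addressClass N h) ≤ (2 ^ N)⁻¹ := by
  have hprob := hν.isProbabilityMeasure
  have hpos : (0 : ℤ) < 2 ^ N := by positivity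
  have hle : ∀ j : ℕ, ν (addressClass N h) ≤ ν (addressClass N j) := fun j => by
    refine (measure_addressClass_le_add hν N h ((j - h) % 2 ^ N).toNat).trans (le_of_eq ?_)
    rw [Int.toNat_of_nonneg (Int.emod_nonneg _ hpos.ne')]
    refine congrArg ν (addressClass_congr ?_)
    rw [show h + (j - h) % 2 ^ N - j = (j - h) % 2 ^ N - (j - h) by ring, dvd_sub_comm]
    exact Int.dvd_self_sub_emod
  have hsum : ∑ j ∈ Finset.range (2 ^ N), ν (addressClass N (j : ℕ)) ≤ 1 := by
    refine le_trans (le_of_eq (measure_biUnion_finset (f := fun j : ℕ => addressClass N j) ?_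
      fun j _ => measurableSet_addressClass N j).symm) prob_le_one
    · intro i hi j hj hij
      refine disjoint_addressClass fun hd => hij ?_
      simp only [Finset.coe_range, Set.mem_Iio] at hi hj
      have := Int.eq_zero_of_abs_lt_dvd hd (by
        rw [abs_lt]
        zify at hi hj
        constructor <;> linarith)
      omega
  have h1 : (2 ^ N : ENNReal) * ν (addressClass N h) ≤ 1 := by
    refine le_trans (le_of_eq ?_) ((Finset.sum_le_sum fun j _ => hle j).trans hsum)
    simp
  rw [ENNReal.le_inv_iff_mul_le, mul_comm]
  exact h1

theorem ae_noEigenvalues_of_invariant (hν : IsInvariantOnSchreierSpace ν) {t u v w : ℝ}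
    (ht : t ≠ 0) (huv : u + v ≠ 0) (huw : u + w ≠ 0) (hvw : v + w ≠ 0) :
    ∀ᵐ x ∂ν, ∀ Γ : RGraph, Γ.cls = x → Γ.NoEigenvalues t u v w := by
  have hdig := ae_exists_digit_eq (ν := ν) (A := fun N h => addressClass N h)
    (fun N h => measure_addressClass_le hν N h) (by
      filter_upwards [hν.ae_mem_closure] with x hx N
      obtain ⟨Γ, rfl⟩ := GraphSpace.exists_rep x
      obtain ⟨σ, hσ, hK⟩ := RGraph.exists_isKleinSystem (Γ := Γ) hx
      obtain ⟨h, H⟩ := RGraph.exists_hasAddress (Γ := Γ) hx hσ hK (N + 1)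
      have hpos : (0 : ℤ) < 2 ^ N := by positivity
      have h0 := Int.emod_nonneg h hpos.ne'
      have h1 := Int.emod_lt_of_pos h hpos
      refine ⟨(h % 2 ^ N).toNat, ?_, mem_addressClass.2 ⟨h, ?_,
        mem_addressSet_of_hasAddress hx hσ H⟩⟩
      · zify
        rwa [Int.toNat_of_nonneg h0]
      · rw [Int.toNat_of_nonneg h0]
        exact Int.dvd_self_sub_emod)
  filter_upwards [hdig, hν.ae_mem_closure] with x hx hcl
  rintro Γ rfl
  obtain ⟨σ, hσ, hK⟩ := RGraph.exists_isKleinSystem hcl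
  refine noEigenvalues_of_digits hσ hK (p := Γ.root) (fun M => ?_) ht huv huw hvw
  obtain ⟨N, h, m, hm, hN, hh, h8⟩ := hx M
  obtain ⟨h', hh', hmem⟩ := mem_addressClass.1 hh
  exact ⟨N, h, m, hm, hN, ((hmem.2 Γ σ rfl hσ).mono (Nat.le_succ N)).congr
    (by rwa [dvd_sub_comm]), h8⟩

end Invariant

/-! ### The glued graphs -/

theorem exists_loopLabel_eq {l : GLabel} (hl : l ≠ .a) (M : ℕ) : ∃ n, M ≤ n ∧ loopLabel n = l := by
  induction M with
  | zero =>
    cases l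
    exacts [absurd rfl hl, ⟨2, by omega, rfl⟩, ⟨1, by omega, rfl⟩, ⟨0, by omega, rfl⟩]
  | succ M ih =>
    obtain ⟨n, hn, h⟩ := ih
    exact ⟨n + 3, by omega, by rw [loopLabel_add_three, h]⟩

open Classical in
/-- The edges of the glued graph `Γ.glue S`, for a graph `Γ` whose edges are given by `σ`. -/
noncomputable def glueFun {V : Type} (σ : GLabel → V → V) (o : V) (S : Set GLabel) (s : GLabel)
    (p : Bool × V) : Bool × V :=
  if s ∈ S ∧ p.2 = o then (!p.1, p.2) else (p.1, σ s p.2)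

section Glue

variable {V : Type} {σ : GLabel → V → V} {o : V} {S : Set GLabel} {l : GLabel}

theorem glueFun_root {s : GLabel} (hs : s ∈ S) (i : Bool) :
    glueFun σ o S s (i, o) = (!i, o) := if_pos ⟨hs, rfl⟩

theorem glueFun_of_notMem {s : GLabel} (hs : s ∉ S) (p : Bool × V) :
    glueFun σ o S s p = (p.1, σ s p.2) := if_neg fun h => hs h.1

theorem glueFun_of_ne {p : V} (hp : p ≠ o) (s : GLabel) (i : Bool) :
    glueFun σ o S s (i, p) = (i, σ s p) := if_neg fun h => hp h.2

theorem represents_glueFun {Γ : RGraph} {σ : GLabel → Γ.V → Γ.V} (hσ : Γ.Represents σ)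
    (ho : ∀ s ∈ S, σ s Γ.root = Γ.root) (hS : S.Nonempty) :
    (Γ.glue S hS).Represents (glueFun σ Γ.root S) := by
  rintro s ⟨i, p⟩ ⟨j, q⟩
  change ((i = j ∧ Γ.Adj s p q ∧ ¬ (s ∈ S ∧ p = Γ.root ∧ q = Γ.root)) ∨
    (i ≠ j ∧ s ∈ S ∧ p = Γ.root ∧ q = Γ.root)) ↔ glueFun σ Γ.root S s (i, p) = (j, q)
  rw [hσ s p q]
  by_cases h : s ∈ S ∧ p = Γ.root
  · obtain ⟨hs, rfl⟩ := h
    rw [glueFun_root hs, ho s hs, Prod.mk.injEq]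
    cases i <;> cases j <;> simp [hs, eq_comm]
  · have : glueFun σ Γ.root S s (i, p) = (i, σ s p) := if_neg h
    rw [this, Prod.mk.injEq]
    tauto

theorem isKleinSystem_glueFun (hK : IsKleinSystem σ) (ho : ∀ s, s ≠ .a → σ s o = o) (hl : l ≠ .a)
    (hS : ∀ s, s ∈ S ↔ s ≠ .a ∧ s ≠ l) : IsKleinSystem (glueFun σ o S) := by
  classical
  have hne : ∀ {p}, p ≠ o → ∀ s, s ≠ .a → σ s p ≠ o := fun hp s hs h =>
    hp ((hK.invol s _).symm.trans (by rw [h, ho s hs]))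
  have hroot : ∀ s i, s ≠ .a → glueFun σ o S s (i, o) = (if s = l then i else !i, o) := by
    intro s i hs
    by_cases h : s = l
    · rw [glueFun_of_notMem fun h' => ((hS s).1 h').2 h, ho s hs, if_pos h]
    · rw [glueFun_root ((hS s).2 ⟨hs, h⟩), if_neg h]
  refine ⟨?_, ?_, ?_⟩
  · rintro s ⟨i, p⟩
    by_cases hs : s ∈ S
    · by_cases hp : p = o
      · subst hp
        rw [glueFun_root hs, glueFun_root hs, Bool.not_not]
      · rw [glueFun_of_ne hp, glueFun_of_ne (hne hp s ((hS s).1 hs).1), hK.invol]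
    · rw [glueFun_of_notMem hs, glueFun_of_notMem hs, hK.invol]
  · rintro ⟨i, p⟩
    by_cases hp : p = o
    · subst hp
      rw [hroot .c _ (by simp), hroot .b _ (by simp), hroot .d _ (by simp)]
      cases l <;> simp at hl ⊢
    · rw [glueFun_of_ne hp, glueFun_of_ne (hne hp _ (by simp)), glueFun_of_ne hp, hK.klein]
  · rintro ⟨i, p⟩
    by_cases hp : p = o
    · subst hp
      rw [hroot .c _ (by simp), hroot .b _ (by simp), hroot .d _ (by simp)]
      cases l <;> simp at hl ⊢
    · simpa only [glueFun_of_ne hp, Prod.mk.injEq, true_and] using hK.fixed p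

theorem isLoopLabel_glueFun_root (ho : ∀ s, s ≠ .a → σ s o = o) (hl : l ≠ .a)
    (hS : ∀ s, s ∈ S ↔ s ≠ .a ∧ s ≠ l) (i : Bool) : IsLoopLabel (glueFun σ o S) l (i, o) := by
  refine ⟨hl, fun s hs => ?_⟩
  by_cases h : s = l
  · rw [glueFun_of_notMem fun h' => ((hS s).1 h').2 h, ho s hs]
    exact iff_of_true rfl h
  · rw [glueFun_root ((hS s).2 ⟨hs, h⟩)]
    simp [h]

theorem isLoopLabel_glueFun {p : V} (hp : p ≠ o) {l' : GLabel} (h : IsLoopLabel σ l' p) (i : Bool) :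
    IsLoopLabel (glueFun σ o S) l' (i, p) :=
  ⟨h.1, fun s hs => by rw [glueFun_of_ne hp, ← h.2 s hs, Prod.mk.injEq, eq_self, true_and]⟩

theorem pairMove_glueFun_of_ne {p : V} (hp : p ≠ o) (i : Bool) :
    pairMove (glueFun σ o S) (i, p) = (i, pairMove σ p) := by
  unfold pairMove
  rw [glueFun_of_ne hp, glueFun_of_ne hp]
  by_cases hb : σ .b p = p
  · rw [if_pos hb, if_pos (by rw [hb])]
  · rw [if_neg hb, if_neg fun h => hb (Prod.mk.inj h).2]

theorem pairMove_glueFun_root (hK : IsKleinSystem σ) (ho : ∀ s, s ≠ .a → σ s o = o) (hl : l ≠ .a)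
    (hS : ∀ s, s ∈ S ↔ s ≠ .a ∧ s ≠ l) (i : Bool) :
    pairMove (glueFun σ o S) (i, o) = (!i, o) := by
  obtain ⟨s, hs, hsl⟩ := GLabel.exists_ne l
  rw [← (isKleinSystem_glueFun hK ho hl hS).pairMove_eq (isLoopLabel_glueFun_root ho hl hS i) hs
    hsl, glueFun_root ((hS s).2 ⟨hs, hsl⟩)]

/-- The line of the fixed point `o` runs through the one-ended graph twice, in opposite directions
for positive and for negative numbers. In the glued graph it runs once through each of the two
copies. -/
theorem glue_line_add_one (hK : IsKleinSystem σ) (ho : ∀ s, s ≠ .a → σ s o = o) (hl : l ≠ .a)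
    (hS : ∀ s, s ∈ S ↔ s ≠ .a ∧ s ≠ l) (hinj : Function.Injective (line σ o)) (k : ℤ) :
    (decide (0 ≤ k + 1), line σ o (k + 1)) =
      pairMove (glueFun σ o S) (glueFun σ o S .a (decide (0 ≤ k), line σ o k)) := by
  have hpair : pairMove σ o = o := by
    obtain ⟨s, hs, h⟩ := IsKleinSystem.pairMove_cases (σ := σ) o
    rw [h, ho s hs]
  rw [glueFun_of_notMem fun h => ((hS .a).1 h).1 rfl]
  by_cases hk : k = -1
  · subst hk
    have h1 : σ .a (line σ o (-1)) = o := by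
      have := hK.line_sub_one o 0
      rw [zero_sub, line_zero, hpair] at this
      rw [this, hK.invol]
    simp only [h1, pairMove_glueFun_root hK ho hl hS]
    rfl
  · have h1 : σ .a (line σ o k) ≠ o := by
      intro h
      have := hK.line_add_one o k
      rw [h, hpair] at this
      have := hinj (this.trans (line_zero σ o).symm)
      omega
    rw [pairMove_glueFun_of_ne h1, hK.line_add_one, Prod.mk.injEq, decide_eq_decide]
    exact ⟨by omega, rfl⟩

end Glue

theorem noEigenvalues_of_iso_glue {Δ : RGraph} {σ : GLabel → Δ.V → Δ.V} (hσ : Δ.Represents σ)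
    (hK : IsKleinSystem σ) (ho : ∀ s, s ≠ .a → σ s Δ.root = Δ.root)
    (hadd : ∀ N, HasAddress σ Δ.root N 0) {S : Set GLabel} (hSn : S.Nonempty) {l : GLabel}
    (hl : l ≠ .a) (hS : ∀ s, s ∈ S ↔ s ≠ .a ∧ s ≠ l) {Γ : LGraph} (f : Γ.V ≃ (Δ.glue S hSn).V)
    (hf : ∀ s p q, Γ.Adj s p q ↔ (Δ.glue S hSn).Adj s (f p) (f q))
    {t u v w : ℝ} (ht : t ≠ 0) (huv : u + v ≠ 0) (huw : u + w ≠ 0) (hvw : v + w ≠ 0) :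
    Γ.NoEigenvalues t u v w := by
  have hinj : Function.Injective (line σ Δ.root) :=
    HasAddress.line_injective hK fun N => ⟨0, hadd N⟩
  set τ := glueFun σ Δ.root S with hτ
  have hrep : (Δ.glue S hSn).Represents τ :=
    represents_glueFun hσ (fun s hs => ho s ((hS s).1 hs).1) hSn
  have hτK : IsKleinSystem τ := isKleinSystem_glueFun hK ho hl hS
  let y : ℤ → (Δ.glue S hSn).V := fun k => (decide (0 ≤ k), line σ Δ.root k)
  have hlab : ∀ k, ∃ l', IsLoopLabel τ l' (y k) ∧ (k = 0 → l' = l) ∧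
      ∀ i, ExactTwoPow i k → l' = loopLabel i := by
    intro k
    by_cases hk : k = 0
    · subst hk
      exact ⟨l, isLoopLabel_glueFun_root ho hl hS _, fun _ => rfl,
        fun i hi => absurd rfl hi.ne_zero⟩
    · have hnd : ¬ (2 : ℤ) ^ k.natAbs ∣ k := fun hd => by
        have := Int.natAbs_le_of_dvd_ne_zero hd hk
        rw [Int.natAbs_pow] at this
        exact absurd this (not_le.2 (Nat.lt_pow_self (by norm_num)))
      obtain ⟨i, -, hi⟩ := ExactTwoPow.exists_lt hnd
      have hne : line σ Δ.root k ≠ Δ.root := fun h => hk (hinj h)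
      have hloop : ∀ j, ExactTwoPow j k → IsLoopLabel τ (loopLabel j) (y k) := fun j hj =>
        isLoopLabel_glueFun hne (hadd (j + 1) k j (Nat.lt_succ_self j) (by rwa [zero_add])) _
      exact ⟨_, hloop i hi, fun h => absurd h hk, fun j hj => (hloop i hi).unique (hloop j hj)⟩
  choose L hL hL0 hLi using hlab
  let σ' : GLabel → Γ.V → Γ.V := fun s p => f.symm (τ s (f p))
  have hστ : ∀ s p, f (σ' s p) = τ s (f p) := fun s p => f.apply_symm_apply _
  refine noEigenvalues_of_line (σ := σ') (y := fun k => f.symm (y k)) (l := L) ?_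
    (hτK.of_injective f.injective hστ) ?_ ?_ ?_ ?_ ht huv huw hvw
  · intro s p q
    rw [hf, hrep, ← hστ, f.injective.eq_iff]
  · intro k
    apply f.injective
    rw [map_pairMove_of_injective f.injective hστ, hστ, f.apply_symm_apply, f.apply_symm_apply]
    exact glue_line_add_one hK ho hl hS hinj k
  · exact f.symm.injective.comp fun j k h => hinj (congrArg Prod.snd h)
  · intro k
    refine IsLoopLabel.of_injective f.injective hστ ?_
    rw [f.apply_symm_apply]
    exact hL k
  · intro M
    -- At the scales `n` with `loopLabel n = l` the edge between the two copies looks like the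
    -- edges at distance `2 ^ n`.
    obtain ⟨n, hn, hnl⟩ := exists_loopLabel_eq hl M
    refine ⟨2 ^ n, hn.trans Nat.lt_two_pow_self.le, fun k hk hk' => ?_⟩
    push_cast at hk ⊢
    have := periodic_around_center (l := L) (n := n) (c := 0)
      (fun j i _ hi => by rw [zero_add]; exact hLi j i hi) (by rw [hL0 0 rfl, hnl]) (j := k) hk
      (hk'.trans_lt (by positivity))
    simpa only [zero_add] using this

theorem noEigenvalues_of_mem_glued {x : GraphSpace} (hx : x ∈ gluedSchreierGraphs) {Γ : RGraph}
    (hΓ : Γ.cls = x) {t u v w : ℝ} (ht : t ≠ 0) (huv : u + v ≠ 0) (huw : u + w ≠ 0)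
    (hvw : v + w ≠ 0) : Γ.NoEigenvalues t u v w := by
  obtain ⟨S, hSn, hS, p, rfl⟩ := hx
  obtain ⟨f, -, hf⟩ := RGraph.iso_of_cls_eq hΓ
  obtain ⟨σ, hrep, hval⟩ := represents_gen fun _ => true
  have hK := isKleinSystem_genFun.of_injective Subtype.val_injective hval
  obtain ⟨l, hl, hSl⟩ : ∃ l, l ≠ .a ∧ ∀ s, s ∈ S ↔ s ≠ .a ∧ s ≠ l := by
    rcases hS with rfl | rfl | rfl
    · exact ⟨.d, by simp, fun s => by cases s <;> simp⟩
    · exact ⟨.c, by simp, fun s => by cases s <;> simp⟩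
    · exact ⟨.b, by simp, fun s => by cases s <;> simp⟩
  refine noEigenvalues_of_iso_glue (Δ := rootedSchreierGraph fun _ => true) hrep hK
    (fun s hs => Subtype.ext ((hval _ _).trans (genFun_ones hs))) (fun N => ?_) hSn hl hSl f hf
    ht huv huw hvw
  refine HasAddress.of_injective isKleinSystem_genFun Subtype.val_injective hval ?_
  have := hasAddress_genFun N fun _ => true
  rwa [address_ones] at this

theorem mainTheorem3 (t u v w : ℝ)
    (ht : t ≠ 0) (huv : u + v ≠ 0) (huw : u + w ≠ 0) (hvw : v + w ≠ 0)
    (hne : ¬ (u = v ∧ v = w)) :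
    ((∀ ν : Measure GraphSpace, IsInvariantOnSchreierSpace ν →
        ∀ᵐ x ∂ν, ∀ Γ : RGraph, Γ.cls = x → Γ.NoEigenvalues t u v w) ∧
      (∀ᵐ ξ ∂boundaryMeasure, (orbitalSchreierGraph ξ).NoEigenvalues t u v w)) ∧
    (∀ x ∈ gluedSchreierGraphs, ∀ Γ : RGraph, Γ.cls = x → Γ.NoEigenvalues t u v w) :=
  ⟨⟨fun _ hν => ae_noEigenvalues_of_invariant hν ht huv huw hvw,
    ae_noEigenvalues_orbital ht huv huw hvw⟩,
    fun _ hx _ hΓ => noEigenvalues_of_mem_glued hx hΓ ht huv huw hvw⟩
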